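/- Let $n\ge 4$ and $m=n-4$. Let $\bar g=\sum_{i=1}^{m}\varepsilon_i\,(dx_i)^2$ with $\varepsilon_i\in\{1,-1\}$ be a flat (pseudo-)Euclidean metric on $\mathbb{R}^{m}$, and write $|x|^2=\sum_i\varepsilon_i x_i^2$ and $|c|^2=\sum_i\varepsilon_i (c^i)^2$. Let $(\widetilde M,\tilde g)$ be a 4-dimensional smooth Einstein manifold, of any signature, i.e. $\widetilde{\mathrm{Ric}}=\tfrac14\widetilde{\mathrm{Sc}}\,\tilde g$. Let $a,b,A,B,c^1,\dots,c^{m}\in\mathbb{R}$ satisfy $\widetilde{\mathrm{Sc}}=-48ab$ and $aB=-bA$, and put $$f(x)=a+b|x|^2,\qquad \sigma(x,q)=A+B|x|^2+\sum_{i=1}^{m}c^i x_i$$ for $x\in\mathbb{R}^{m}$, $q\in\widetilde M$. Let $M'\subseteq\mathbb{R}^{m}\times\widetilde M$ be the open subset on which $f\neq0$, so that the warped product $g=\bar g\oplus f^2\tilde g$ is a smooth semi-Riemannian metric on $M'$. Let $\nabla$ be its Levi-Civita connection and $\mathsf P=\frac1{n-2}\bigl(\mathrm{Ric}-\frac{\mathrm{Sc}}{2(n-1)}\,g\bigr)$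 its Schouten tensor. (a) On $M'$ one has $(\nabla\nabla\sigma+\mathsf P\,\sigma)_0=0$, where $(\ )_0$ denotes the trace-free part with respect to $g$; that is, the density of conformal weight 1 given by $\sigma$ in the scale $g$ is an almost Einstein scale on $(M',[g])$. (b) On the open subset $M_\sigma\subseteq M'$ where $\sigma\neq0$, the metric $\sigma^{-2}g$ has scalar curvature $$\mathrm{Sc}^\sigma=n(n-1)\bigl(4AB-|c|^2\bigr).$$ -/

import Mathlib

set_option maxSynthPendingDepth 3

open Bundle Module
open scoped Manifold ContDiff

noncomputable section

namespace SemiRiem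

/-! ### Linear algebra of nondegenerate bilinear forms -/

section Algebra

variable {E : Type*} [AddCommGroup E] [Module ℝ E] [TopologicalSpace E]
  [IsTopologicalAddGroup E] [ContinuousSMul ℝ E]

/-- The trace `g^{ab} B_{ab}` of a bilinear form `B` with respect to a nondegenerate form `g`:
the trace of the endomorphism `B_a{}^b` obtained by raising an index with `g`. Here `g` is read as
the map `v ↦ g(v, ·)`, so that `g.inverse` is the inverse metric (raising of an index). -/
def metricTrace (g B : E →L[ℝ] E →L[ℝ] ℝ) : ℝ :=
  LinearMap.trace ℝ E (g.inverse ∘L B : E →L[ℝ] E)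

/-- The trace-free part `B₀ = B - (1/n) (tr_g B) g` of a bilinear form, `n` the dimension. -/
def traceFreePart (g B : E →L[ℝ] E →L[ℝ] ℝ) : E →L[ℝ] E →L[ℝ] ℝ :=
  B - ((finrank ℝ E : ℝ)⁻¹ * metricTrace g B) • g

end Algebra

/-! ### Levi-Civita connection and curvature in a coordinate domain

`G` is a field of bilinear forms on a finite-dimensional vector space `E` (the coordinate space),
and `y` is a point of `E`. -/

section Local

variable {E : Type*} [NormedAddCommGroup E] [NormedSpace ℝ E] [FiniteDimensional ℝ E]

/-- Christoffel symbols of the first kind: the covector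
`Γ(u,v,w) = ½ (∂_u G(v,w) + ∂_v G(u,w) - ∂_w G(u,v))`, written through `D(u,v,w) = ∂_u G(v,w)`
and permutations of its arguments. -/
def christoffelFirst (G : E → E →L[ℝ] E →L[ℝ] ℝ) (y : E) : E →L[ℝ] E →L[ℝ] (E →L[ℝ] ℝ) :=
  let D : E →L[ℝ] E →L[ℝ] E →L[ℝ] ℝ := fderiv ℝ G y
  (2⁻¹ : ℝ) • (D + D.flip
    - (ContinuousLinearMap.flipₗᵢ ℝ E E ℝ).toContinuousLinearEquiv.toContinuousLinearMap ∘L D.flip)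

set_option linter.unusedSectionVars false in
theorem christoffelFirst_apply (G : E → E →L[ℝ] E →L[ℝ] ℝ) (y u v w : E) :
    christoffelFirst G y u v w =
      2⁻¹ * (fderiv ℝ G y u v w + fderiv ℝ G y v u w - fderiv ℝ G y w u v) :=
  rfl

/-- Christoffel symbols of the Levi-Civita connection: the vector `Γ(u,v) = ∇_u v` for constant
(coordinate) vector fields `u`, `v`, i.e. the covector above with its last index raised. -/
def christoffel (G : E → E →L[ℝ] E →L[ℝ] ℝ) (y : E) : E →L[ℝ] E →L[ℝ] E :=
  ContinuousLinearMap.compL ℝ E (E →L[ℝ] ℝ) E (G y).inverse ∘L christoffelFirst G y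

/-- The curvature `R(u,v)w = ∇_u ∇_v w - ∇_v ∇_u w` for constant vector fields `u`, `v`, `w`. -/
def curvature (G : E → E →L[ℝ] E →L[ℝ] ℝ) (y u v w : E) : E :=
  fderiv ℝ (christoffel G) y u v w - fderiv ℝ (christoffel G) y v u w
    + christoffel G y u (christoffel G y v w) - christoffel G y v (christoffel G y u w)

/-- The endomorphism `u ↦ R(u,v)w`. -/
def curvatureEnd (G : E → E →L[ℝ] E →L[ℝ] ℝ) (y v w : E) : E →ₗ[ℝ] E where
  toFun u := curvature G y u v w
  map_add' u u' := by
    unfold curvature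
    generalize fderiv ℝ (christoffel G) y = D
    generalize christoffel G y = Γ
    simp only [map_add, add_apply]
    abel
  map_smul' c u := by
    unfold curvature
    generalize fderiv ℝ (christoffel G) y = D
    generalize christoffel G y = Γ
    simp only [map_smul, smul_apply, RingHom.id_apply, smul_sub, smul_add]

/-- The Ricci tensor `Ric(v,w) = tr (u ↦ R(u,v)w)`. -/
def localRicci (G : E → E →L[ℝ] E →L[ℝ] ℝ) (y : E) : E →L[ℝ] E →L[ℝ] ℝ :=
  (LinearMap.mk₂ ℝ (fun v w : E ↦ LinearMap.trace ℝ E (curvatureEnd G y v w))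
    (by
      intro v v' w
      rw [← map_add]
      congr 1
      ext u
      change curvature G y u (v + v') w = curvature G y u v w + curvature G y u v' w
      unfold curvature
      generalize fderiv ℝ (christoffel G) y = D
      generalize christoffel G y = Γ
      simp only [map_add, add_apply]
      abel)
    (by
      intro c v w
      rw [← map_smul]
      congr 1
      ext u
      change curvature G y u (c • v) w = c • curvature G y u v w
      unfold curvature
      generalize fderiv ℝ (christoffel G) y = D
      generalize christoffel G y = Γ
      simp only [map_smul, smul_apply, smul_sub, smul_add])
    (by
      intro v w w'
      rw [← map_add]
      congr 1
      ext u
      change curvature G y u v (w + w') = curvature G y u v w + curvature G y u v w'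
      unfold curvature
      generalize fderiv ℝ (christoffel G) y = D
      generalize christoffel G y = Γ
      simp only [map_add]
      abel)
    (by
      intro c v w
      rw [← map_smul]
      congr 1
      ext u
      change curvature G y u v (c • w) = c • curvature G y u v w
      unfold curvature
      generalize fderiv ℝ (christoffel G) y = D
      generalize christoffel G y = Γ
      simp only [map_smul, smul_sub, smul_add])).toContinuousBilinearMap

/-- The Hessian `(∇∇s)(u,v) = ∂_u ∂_v s - ds(∇_u v)` of a function. -/
def localHessian (G : E → E →L[ℝ] E →L[ℝ] ℝ) (s : E → ℝ) (y : E) : E →L[ℝ] E →L[ℝ] ℝ :=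
  fderiv ℝ (fderiv ℝ s) y
    - ContinuousLinearMap.compL ℝ E E ℝ (fderiv ℝ s y) ∘L christoffel G y

end Local

/-! ### Semi-Riemannian metrics on manifolds

`M` is a manifold without boundary modelled on the finite-dimensional space `E`. Tensors at `p` are
computed in the preferred chart at `p`, whose differential at `p` is the identification of the
tangent space at `p` with `E` on which the definition of `TangentSpace` rests. -/

section Manifold

variable {E : Type*} [NormedAddCommGroup E] [NormedSpace ℝ E] [FiniteDimensional ℝ E]
  {H : Type*} [TopologicalSpace H] {I : ModelWithCorners ℝ E H}
  {M : Type*} [TopologicalSpace M] [ChartedSpace H M]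

variable (I M) in
/-- Fields of bilinear forms on the tangent spaces of `M` (no regularity is included). -/
abbrev FormField : Type _ :=
  ∀ p : M, TangentSpace I p →L[ℝ] TangentSpace I p →L[ℝ] ℝ

/-- On the open set `U`, the field `g` is a semi-Riemannian metric of class `C^∞`. -/
structure IsMetricOn [IsManifold I 1 M] (g : FormField I M) (U : Set M) : Prop where
  isOpen : IsOpen U
  symm : ∀ p ∈ U, ∀ v w : TangentSpace I p, g p v w = g p w v
  nondegenerate : ∀ p ∈ U, ∀ v : TangentSpace I p,
    (∀ w : TangentSpace I p, g p v w = 0) → v = 0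
  contMDiffOn : ContMDiffOn I (I.prod 𝓘(ℝ, E →L[ℝ] E →L[ℝ] ℝ)) ∞
    (fun p ↦ TotalSpace.mk' (E →L[ℝ] E →L[ℝ] ℝ)
      (E := fun p : M ↦ TangentSpace I p →L[ℝ] TangentSpace I p →L[ℝ] ℝ) p (g p)) U

/-- The metric `g` in the coordinates of the preferred chart at `p`: the pullback of `g` by the
inverse of that chart. -/
def coordMetric (g : FormField I M) (p : M) (y : E) : E →L[ℝ] E →L[ℝ] ℝ :=
  let A : E →L[ℝ] TangentSpace I ((extChartAt I p).symm y) :=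
    mfderiv 𝓘(ℝ, E) I (extChartAt I p).symm y
  (LinearMap.mk₂ ℝ (fun u v : E ↦ g ((extChartAt I p).symm y) (A u) (A v))
    (by intro u u' v; rw [map_add, map_add]; rfl)
    (by intro c u v; rw [map_smul, map_smul]; rfl)
    (by intro u v v'; rw [map_add, map_add])
    (by intro c u v; rw [map_smul, map_smul])).toContinuousBilinearMap

/-- The Ricci tensor of `g`. -/
def ricci (g : FormField I M) : FormField I M :=
  fun p ↦ localRicci (E := E) (coordMetric g p) (extChartAt I p p)

/-- The Hessian `∇∇s` of the function `s`, `∇` the Levi-Civita connection of `g`. -/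
def hessian (g : FormField I M) (s : M → ℝ) : FormField I M :=
  fun p ↦ localHessian (E := E) (coordMetric g p) (s ∘ (extChartAt I p).symm) (extChartAt I p p)

/-- The scalar curvature of `g`. -/
def scalarCurvature (g : FormField I M) (p : M) : ℝ :=
  metricTrace (E := TangentSpace I p) (g p) (ricci g p)

/-- The Schouten tensor `P = 1/(n-2) (Ric - Sc/(2(n-1)) g)`, `n ≥ 3` the dimension. -/
def schouten (g : FormField I M) : FormField I M :=
  fun p ↦ ((finrank ℝ E : ℝ) - 2)⁻¹ •
    (ricci g p - (scalarCurvature g p / (2 * ((finrank ℝ E : ℝ) - 1))) • g p)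

/-- `g` is an Einstein metric on `M`: `Ric = (Sc/n) g`. -/
structure IsEinstein [IsManifold I 1 M] (g : FormField I M) : Prop where
  isMetric : IsMetricOn g Set.univ
  ricci_eq : ∀ p, ricci g p = (scalarCurvature g p / (finrank ℝ E : ℝ)) • g p

/-- The density of weight one which is given by the function `s` in the scale of the metric `g`
is an almost Einstein scale on `U`: `s` is smooth and `(∇∇s + P s)₀ = 0`. -/
structure IsAlmostEinsteinScaleOn (g : FormField I M) (s : M → ℝ) (U : Set M) : Prop where
  contMDiffOn : ContMDiffOn I 𝓘(ℝ) ∞ s U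
  traceFree_eq_zero : ∀ p ∈ U, traceFreePart (g p) (hessian g s p + s p • schouten g p) = 0

end Manifold

/-! ### Warped products and the pseudo-Euclidean base -/

section Warped

variable {E : Type*} [NormedAddCommGroup E] [NormedSpace ℝ E] [FiniteDimensional ℝ E]
  {H : Type*} [TopologicalSpace H] {I : ModelWithCorners ℝ E H}
  {M : Type*} [TopologicalSpace M] [ChartedSpace H M]
  {E' : Type*} [NormedAddCommGroup E'] [NormedSpace ℝ E'] [FiniteDimensional ℝ E']
  {H' : Type*} [TopologicalSpace H'] {I' : ModelWithCorners ℝ E' H'}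
  {M' : Type*} [TopologicalSpace M'] [ChartedSpace H' M']

/-- The warped product `g₁ ⊕ f² g₂` on `M × M'`, with a function `f` on the base `M`. -/
def warpedProduct (g₁ : FormField I M) (g₂ : FormField I' M') (f : M → ℝ) :
    FormField (I.prod I') (M × M') :=
  fun p ↦
    let G₁ : E →L[ℝ] E →L[ℝ] ℝ := g₁ p.1
    let G₂ : E' →L[ℝ] E' →L[ℝ] ℝ := g₂ p.2
    (LinearMap.mk₂ ℝ (fun v w : E × E' ↦ G₁ v.1 w.1 + f p.1 ^ 2 * G₂ v.2 w.2)
      (by intros; simp; ring) (by intros; simp; ring)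
      (by intros; simp; ring) (by intros; simp; ring)).toContinuousBilinearMap

/-- The flat metric `∑ εᵢ (dxᵢ)²` on `ℝᵐ`; the signs `εᵢ = ±1` give the signature. -/
def flatMetric {m : ℕ} (ε : Fin m → ℝ) : FormField (𝓡 m) (EuclideanSpace ℝ (Fin m)) :=
  fun _ ↦ (LinearMap.mk₂ ℝ
    (fun v w : EuclideanSpace ℝ (Fin m) ↦ ∑ i, ε i * (v i * w i))
    (by intros; simp only [PiLp.add_apply, ← Finset.sum_add_distrib]; congr! 1; ring)
    (by intros; simp only [PiLp.smul_apply, smul_eq_mul, Finset.mul_sum]; congr! 1; ring)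
    (by intros; simp only [PiLp.add_apply, ← Finset.sum_add_distrib]; congr! 1; ring)
    (by intros; simp only [PiLp.smul_apply, smul_eq_mul, Finset.mul_sum]; congr! 1; ring)).toContinuousBilinearMap

/-- The square `∑ εᵢ (xᵢ)²` of the pseudo-Euclidean norm. -/
def normSq {m : ℕ} (ε : Fin m → ℝ) (x : EuclideanSpace ℝ (Fin m)) : ℝ :=
  ∑ i, ε i * x i ^ 2

end Warped

end SemiRiem

end

/-! Both claims come from one computation: the Ricci tensor of `s⁻² (η ⊕ f² G)`, with `η` a constant
form on the base and `f`, `s` functions on the base whose gradients `F`, `S` satisfy `DF = k id`,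
`DS = l id`. Taking `s = 1` gives `g` and `s = σ` gives `σ⁻² g`; here `F = 2b x`, `k = 2b`, `l =
2B`, and `S` is `2B x` plus the vector dual to `c`.

The Christoffel symbols are explicit. The diagonal blocks of `u ↦ R(u,v)w` are scalars plus rank-one
maps, plus the fibre curvature in the fibre block, so their traces can be read off
(`localRicci_warpedForm`).

The hypotheses on the constants enter through two identities. The fibre has `Ric = -12ab gN`, hence
`-12ab - 3 η(F,F) = -12 b f`; and `aB = -bA` says exactly that `η(S,F) = 2B f + 2b σ`.

For (a), the first identity gives `P = -2b f G`, with no base component, while `∇∇σ = l η + f η(S,F)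
G`. The second identity then turns `∇∇σ + σ P` into `l η + l f² G = 2B g`, a pure trace.

For (b), the same identities cancel all terms containing `1/f` and leave `n(n-1) (4B σ - η(S,S))`.
The dependence on `x` drops out, since `η(S,S) = 4B²|x|² + 4B c·x + |c|²`. -/

noncomputable section

namespace SemiRiem

/-! ### Metrics read in the preferred chart. -/

section ManifoldLemmas

variable {E : Type*} [NormedAddCommGroup E] [NormedSpace ℝ E]
  {H : Type*} [TopologicalSpace H] {I : ModelWithCorners ℝ E H}
  {M : Type*} [TopologicalSpace M] [ChartedSpace H M]

theorem FormField.congr_point (g : FormField I M) {x y : M} (h : x = y) (u v : E) :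
    (show E →L[ℝ] E →L[ℝ] ℝ from g x) u v = (show E →L[ℝ] E →L[ℝ] ℝ from g y) u v := by
  rw [h]

/-- The tangent coordinate change from a chart to itself is the identity. This lets tensors computed
in the chart at `p` be compared directly with `g p`. -/
theorem mfderiv_extChartAt_symm_self [I.Boundaryless] [IsManifold I 1 M] (p : M) :
    (mfderiv 𝓘(ℝ, E) I (extChartAt I p).symm (extChartAt I p p) : E →L[ℝ] E) =
      ContinuousLinearMap.id ℝ E := by
  have h := TangentBundle.symmL_trivializationAt (I := I) (mem_chart_source H p)
  rw [I.range_eq_univ, mfderivWithin_univ] at h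
  refine h.symm.trans ?_
  rw [TangentBundle.symmL_trivializationAt_eq_core (mem_chart_source H p)]
  ext v
  exact (tangentBundleCore I M).coordChange_self (achart H p) p (mem_chart_source H p) v

variable [FiniteDimensional ℝ E]

theorem coordMetric_apply (g : FormField I M) (p : M) (y u v : E) :
    coordMetric g p y u v = g ((extChartAt I p).symm y)
      (mfderiv 𝓘(ℝ, E) I (extChartAt I p).symm y u)
      (mfderiv 𝓘(ℝ, E) I (extChartAt I p).symm y v) :=
  rfl

variable [I.Boundaryless] [IsManifold I 1 M]

theorem coordMetric_self (g : FormField I M) (p : M) :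
    coordMetric g p (extChartAt I p p) = g p := by
  ext u v
  rw [coordMetric_apply]
  have h := mfderiv_extChartAt_symm_self (I := I) p
  have h1 (w : E) : mfderiv 𝓘(ℝ, E) I (extChartAt I p).symm (extChartAt I p p) w = w :=
    DFunLike.congr_fun h w
  rw [h1, h1]
  exact g.congr_point (extChartAt_to_inv p) u v

theorem inCoordinates_eq_coordMetric (g : FormField I M) {p x : M}
    (hx : x ∈ (chartAt H p).source) :
    ContinuousLinearMap.inCoordinates E (TangentSpace I) (E →L[ℝ] ℝ)
      (fun p : M ↦ TangentSpace I p →L[ℝ] ℝ) p x p x (g x) =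
      coordMetric g p (extChartAt I p x) := by
  ext u v
  have hx' : x ∈ (trivializationAt E (TangentSpace I) p).baseSet := by
    simpa using hx
  have := inCoordinates_apply_eq₂ (F₁ := E) (F₂ := E) (F₃ := ℝ)
    (E₁ := (TangentSpace I : M → Type _)) (E₂ := (TangentSpace I : M → Type _))
    (E₃ := Trivial M ℝ) (ϕ := g x) (v := u) (w := v) hx' hx' (by simp)
  refine this.trans ?_
  rw [coordMetric_apply]
  have h := TangentBundle.symmL_trivializationAt (I := I) hx
  rw [I.range_eq_univ, mfderivWithin_univ] at h
  have h1 (w : E) : (trivializationAt E (TangentSpace I) p).symm x w =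
      mfderiv 𝓘(ℝ, E) I (extChartAt I p).symm (extChartAt I p x) w :=
    (Trivialization.symmL_apply (R := ℝ) _ hx' w).symm.trans (DFunLike.congr_fun h w)
  rw [h1, h1]
  have h2 : (extChartAt I p).symm (extChartAt I p x) = x :=
    (extChartAt I p).left_inv (by rwa [extChartAt_source])
  have h3 (r : ℝ) : (trivializationAt ℝ (Trivial M ℝ) p).linearMapAt ℝ x r = r := by
    simp
  rw [h3]
  exact (g.congr_point h2 _ _).symm

/-- Near `p`, the bundle trivialization at `p` reads `g` as its pullback by the inverse chart.
Smoothness thus passes between the intrinsic definition and the coordinate calculus. -/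
theorem contMDiffAt_form_iff [IsManifold I ∞ M] (g : FormField I M) (p : M) :
    ContMDiffAt I (I.prod 𝓘(ℝ, E →L[ℝ] E →L[ℝ] ℝ)) ∞
    (fun p ↦ TotalSpace.mk' (E →L[ℝ] E →L[ℝ] ℝ)
      (E := fun p : M ↦ TangentSpace I p →L[ℝ] TangentSpace I p →L[ℝ] ℝ) p (g p)) p ↔
    ContDiffAt ℝ ∞ (coordMetric g p) (extChartAt I p p) := by
  rw [contMDiffAt_section]
  have h : (fun x ↦ (trivializationAt (E →L[ℝ] E →L[ℝ] ℝ)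
      (fun p : M ↦ TangentSpace I p →L[ℝ] TangentSpace I p →L[ℝ] ℝ) p ⟨x, g x⟩).2) =ᶠ[nhds p]
      coordMetric g p ∘ extChartAt I p := by
    filter_upwards [(chartAt H p).open_source.mem_nhds (mem_chart_source H p)] with x hx
    exact inCoordinates_eq_coordMetric g hx
  rw [h.contMDiffAt_iff]
  constructor
  · intro h
    rw [← contMDiffAt_iff_contDiffAt]
    have h2 : ContMDiffAt 𝓘(ℝ, E) I ∞ (extChartAt I p).symm (extChartAt I p p) :=
      (contMDiffOn_extChartAt_symm p).contMDiffAt (extChartAt_target_mem_nhds p)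
    have h3 := ContMDiffAt.comp (extChartAt I p p) (by rwa [extChartAt_to_inv]) h2
    refine h3.congr_of_eventuallyEq ?_
    filter_upwards [extChartAt_target_mem_nhds (I := I) p] with y hy
    exact congrArg (coordMetric g p) ((extChartAt I p).right_inv hy).symm
  · intro h
    exact h.contMDiffAt.comp p contMDiffAt_extChartAt

end ManifoldLemmas

/-! ### Orthogonal sums and charts of products. -/

section BlockForm

variable {E : Type*} [NormedAddCommGroup E] [NormedSpace ℝ E]
  {E' : Type*} [NormedAddCommGroup E'] [NormedSpace ℝ E']

/-- The orthogonal sum of two bilinear forms. -/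
def blockForm (η : E →L[ℝ] E →L[ℝ] ℝ) (θ : E' →L[ℝ] E' →L[ℝ] ℝ) :
    (E × E') →L[ℝ] (E × E') →L[ℝ] ℝ :=
  η.bilinearComp (.fst ℝ E E') (.fst ℝ E E') + θ.bilinearComp (.snd ℝ E E') (.snd ℝ E E')

end BlockForm

section Differentiability

variable {E : Type*} [NormedAddCommGroup E] [NormedSpace ℝ E]
  {H : Type*} [TopologicalSpace H] {I : ModelWithCorners ℝ E H}
  {M : Type*} [TopologicalSpace M] [ChartedSpace H M]

theorem mdifferentiableAt_extChartAt_symm [I.Boundaryless] [IsManifold I 1 M] {p : M} {y : E}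
    (hy : y ∈ (extChartAt I p).target) :
    MDifferentiableAt 𝓘(ℝ, E) I (extChartAt I p).symm y := by
  have := mdifferentiableWithinAt_extChartAt_symm hy
  rwa [I.range_eq_univ, mdifferentiableWithinAt_univ] at this

variable {E' : Type*} [NormedAddCommGroup E'] [NormedSpace ℝ E']
  {H' : Type*} [TopologicalSpace H'] {I' : ModelWithCorners ℝ E' H'}
  {M' : Type*} [TopologicalSpace M'] [ChartedSpace H' M']

theorem mfderiv_extChartAt_symm_prod [I.Boundaryless] [IsManifold I 1 M] [I'.Boundaryless]
    [IsManifold I' 1 M'] (p : M × M') {y : E} {z : E'}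
    (hy : y ∈ (extChartAt I p.1).target) (hz : z ∈ (extChartAt I' p.2).target) :
    (mfderiv 𝓘(ℝ, E × E') (I.prod I') (extChartAt (I.prod I') p).symm (y, z) :
      E × E' →L[ℝ] E × E') =
    ContinuousLinearMap.prodMap (mfderiv 𝓘(ℝ, E) I (extChartAt I p.1).symm y : E →L[ℝ] E)
      (mfderiv 𝓘(ℝ, E') I' (extChartAt I' p.2).symm z : E' →L[ℝ] E') := by
  refine HasMFDerivAt.mfderiv (f := (extChartAt (I.prod I') p).symm) ?_
  rw [modelWithCornersSelf_prod, ← chartedSpaceSelf_prod, extChartAt_prod]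
  exact (mdifferentiableAt_extChartAt_symm hy).hasMFDerivAt.prodMap (p := (y, z))
    (mdifferentiableAt_extChartAt_symm hz).hasMFDerivAt

end Differentiability

section Coordinates

variable {E : Type*} [NormedAddCommGroup E] [NormedSpace ℝ E] [FiniteDimensional ℝ E]
  {H : Type*} [TopologicalSpace H] {I : ModelWithCorners ℝ E H}
  {M : Type*} [TopologicalSpace M] [ChartedSpace H M]
  {E' : Type*} [NormedAddCommGroup E'] [NormedSpace ℝ E'] [FiniteDimensional ℝ E']
  {H' : Type*} [TopologicalSpace H'] {I' : ModelWithCorners ℝ E' H'}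
  {M' : Type*} [TopologicalSpace M'] [ChartedSpace H' M']

theorem coordMetric_smul (g : FormField I M) (c : M → ℝ) (p : M) (y : E) :
    coordMetric (fun x ↦ c x • g x) p y = c ((extChartAt I p).symm y) • coordMetric g p y :=
  rfl

theorem coordMetric_warpedProduct [I.Boundaryless] [IsManifold I 1 M] [I'.Boundaryless]
    [IsManifold I' 1 M'] (g₁ : FormField I M) (g₂ : FormField I' M') (f : M → ℝ) (p : M × M')
    {y : E} {z : E'}
    (hy : y ∈ (extChartAt I p.1).target) (hz : z ∈ (extChartAt I' p.2).target) :
    coordMetric (warpedProduct g₁ g₂ f) p (y, z) =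
      blockForm (coordMetric g₁ p.1 y)
        (f ((extChartAt I p.1).symm y) ^ 2 • coordMetric g₂ p.2 z) := by
  refine ContinuousLinearMap.ext fun u ↦ ContinuousLinearMap.ext fun v ↦ ?_
  rw [coordMetric_apply]
  have h (w : E × E') : mfderiv 𝓘(ℝ, E × E') (I.prod I') (extChartAt (I.prod I') p).symm (y, z) w =
    (mfderiv 𝓘(ℝ, E) I (extChartAt I p.1).symm y w.1,
      mfderiv 𝓘(ℝ, E') I' (extChartAt I' p.2).symm z w.2) :=
    DFunLike.congr_fun (mfderiv_extChartAt_symm_prod p hy hz) w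
  rw [h, h, extChartAt_prod]
  rfl

/-- The bilinear form `∑ εᵢ (dxᵢ)²` on `ℝᵐ`. -/
def flatForm {m : ℕ} (ε : Fin m → ℝ) :
    EuclideanSpace ℝ (Fin m) →L[ℝ] EuclideanSpace ℝ (Fin m) →L[ℝ] ℝ :=
  flatMetric ε 0

theorem flatForm_apply {m : ℕ} (ε : Fin m → ℝ) (u v : EuclideanSpace ℝ (Fin m)) :
    flatForm ε u v = ∑ i, ε i * (u i * v i) :=
  rfl

theorem coordMetric_flatMetric {m : ℕ} (ε : Fin m → ℝ) (x y : EuclideanSpace ℝ (Fin m)) :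
    coordMetric (flatMetric ε) x y = flatForm ε := by
  ext u v
  rw [coordMetric_apply]
  have h : (extChartAt (𝓡 m) x).symm = PartialEquiv.refl _ := by
    rw [extChartAt_model_space_eq_id]; rfl
  have h1 (w : EuclideanSpace ℝ (Fin m)) :
      mfderiv (𝓡 m) (𝓡 m) (extChartAt (𝓡 m) x).symm y w = w := by
    rw [h]
    exact DFunLike.congr_fun mfderiv_id w
  rw [h1, h1]
  rfl

end Coordinates

/-! ### Calculus of Christoffel symbols in a coordinate domain. -/

section LocalLemmas

variable {E : Type*} [NormedAddCommGroup E] [NormedSpace ℝ E]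
  {V : Type*} [NormedAddCommGroup V] [NormedSpace ℝ V]

theorem hasDerivAt_line {Φ : E → V} {p : E} {Φ' : E →L[ℝ] V} (h : HasFDerivAt Φ Φ' p) (t : E) :
    HasDerivAt (fun r : ℝ ↦ Φ (p + r • t)) (Φ' t) 0 :=
  h.hasLineDerivAt t

theorem fderiv_bilinear_apply {W : Type*} [NormedAddCommGroup W] [NormedSpace ℝ W]
    {G : E → V →L[ℝ] V →L[ℝ] W} {p : E} (hG : DifferentiableAt ℝ G p) (t : E) (u v : V) :
    fderiv ℝ G p t u v = fderiv ℝ (fun y ↦ G y u v) p t := by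
  have h := (hG.hasFDerivAt.clm_apply (hasFDerivAt_const u p)).clm_apply (hasFDerivAt_const v p)
  rw [h.fderiv]
  simp

theorem hasDerivAt_bilinear_line {W : Type*} [NormedAddCommGroup W] [NormedSpace ℝ W]
    {G : E → V →L[ℝ] V →L[ℝ] W} {p : E} (hG : DifferentiableAt ℝ G p) (t : E) (u v : V) :
    HasDerivAt (fun r : ℝ ↦ G (p + r • t) u v) (fderiv ℝ G p t u v) 0 := by
  have := ((hasDerivAt_line hG.hasFDerivAt t).clm_apply (hasDerivAt_const 0 u)).clm_apply
    (hasDerivAt_const 0 v)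
  simpa using this

theorem nondegenerate_of_isInvertible {G : E →L[ℝ] E →L[ℝ] ℝ} (hG : G.IsInvertible) (v : E)
    (h : ∀ w, G v w = 0) : v = 0 := by
  obtain ⟨e, rfl⟩ := hG
  exact e.injective (by ext w; simpa using h w)

/-- A candidate is verified by the Koszul formula, paired against every `w`, so the inverse metric
never has to be computed. -/
theorem christoffel_eq {G : E → E →L[ℝ] E →L[ℝ] ℝ} {y u v X : E} (hG : (G y).IsInvertible)
    (h : ∀ w, G y X w = christoffelFirst G y u v w) : christoffel G y u v = X := by
  have h' : G y X = christoffelFirst G y u v := ContinuousLinearMap.ext h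
  change (G y).inverse (christoffelFirst G y u v) = X
  rw [← h']
  exact DFunLike.congr_fun hG.inverse_comp_self X

theorem apply_christoffel {G : E → E →L[ℝ] E →L[ℝ] ℝ} {y : E} (hG : (G y).IsInvertible)
    (u v w : E) : G y (christoffel G y u v) w = christoffelFirst G y u v w := by
  change G y ((G y).inverse (christoffelFirst G y u v)) w = _
  exact DFunLike.congr_fun (DFunLike.congr_fun hG.self_comp_inverse _) w

theorem curvatureEnd_apply (G : E → E →L[ℝ] E →L[ℝ] ℝ) (y u v w : E) :
    curvatureEnd G y v w u = fderiv ℝ (christoffel G) y u v w - fderiv ℝ (christoffel G) y v u w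
    + christoffel G y u (christoffel G y v w) - christoffel G y v (christoffel G y u w) :=
  rfl

theorem localHessian_apply (G : E → E →L[ℝ] E →L[ℝ] ℝ) (s : E → ℝ) (y u v : E) :
    localHessian G s y u v = fderiv ℝ (fderiv ℝ s) y u v - fderiv ℝ s y (christoffel G y u v) :=
  rfl

/-- Connection, Hessian and Ricci tensor depend only on germs; this matters because the coordinate
metric is known only over a chart domain. -/
theorem christoffel_congr {G G' : E → E →L[ℝ] E →L[ℝ] ℝ} {y : E} (h : G =ᶠ[nhds y] G') :
    christoffel G y = christoffel G' y := by
  unfold christoffel christoffelFirst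
  rw [h.eq_of_nhds, h.fderiv_eq]

theorem localHessian_congr {G G' : E → E →L[ℝ] E →L[ℝ] ℝ} {s s' : E → ℝ} {y : E}
    (h : G =ᶠ[nhds y] G') (hs : s =ᶠ[nhds y] s') :
    localHessian G s y = localHessian G' s' y := by
  unfold localHessian
  rw [christoffel_congr h, hs.fderiv_eq, hs.fderiv.fderiv_eq]

variable [FiniteDimensional ℝ E]

theorem isInvertible_of_nondegenerate {G : E →L[ℝ] E →L[ℝ] ℝ}
    (hG : ∀ v, (∀ w, G v w = 0) → v = 0) : G.IsInvertible := by
  have hinj : Function.Injective (G : E →ₗ[ℝ] E →L[ℝ] ℝ) := by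
    rw [← LinearMap.ker_eq_bot, LinearMap.ker_eq_bot']
    intro v hv
    exact hG v fun w ↦ DFunLike.congr_fun hv w
  have hdim : finrank ℝ E = finrank ℝ (E →L[ℝ] ℝ) := by
    rw [← Subspace.dual_finrank_eq (K := ℝ) (V := E)]
    exact (LinearMap.toContinuousLinearMap (𝕜 := ℝ) (E := E) (F' := ℝ)).finrank_eq
  exact ⟨(LinearEquiv.ofInjectiveOfFinrankEq _ hinj hdim).toContinuousLinearEquiv, by ext; rfl⟩

theorem eventually_isInvertible {G : E → E →L[ℝ] E →L[ℝ] ℝ} {y : E} (hG : ContinuousAt G y)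
    (hy : (G y).IsInvertible) : ∀ᶠ z in nhds y, (G z).IsInvertible := by
  obtain ⟨e, he⟩ := hy
  exact hG.eventually (by rw [← he]; exact e.nhds)

set_option synthInstance.maxHeartbeats 200000 in
theorem contDiffAt_christoffel {G : E → E →L[ℝ] E →L[ℝ] ℝ} {y : E} (hG : ContDiffAt ℝ ∞ G y)
    (hy : (G y).IsInvertible) : ContDiffAt ℝ ∞ (christoffel G) y := by
  have h1 : ContDiffAt ℝ ∞ (fderiv ℝ G) y := hG.fderiv_right (m := ∞) (by simp)
  have h2 : ContDiffAt ℝ ∞ (fun y ↦ (G y).inverse) y :=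
    (ContinuousLinearMap.IsInvertible.contDiffAt_map_inverse hy).comp y hG
  have h3 : ContDiffAt ℝ ∞ (christoffelFirst G) y := by
    have hflip : ContDiffAt ℝ ∞ (fun y ↦ (fderiv ℝ G y).flip) y :=
      ((ContinuousLinearMap.flipₗᵢ ℝ E E (E →L[ℝ] ℝ)).contDiff.contDiffAt).comp y h1
    exact ((h1.add hflip).sub (contDiffAt_const.clm_comp hflip)).const_smul _
  exact ((ContinuousLinearMap.contDiff _).contDiffAt.comp y h2).clm_comp h3

theorem christoffel_symm {G : E → E →L[ℝ] E →L[ℝ] ℝ} {y : E} (hG : DifferentiableAt ℝ G y)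
    (hsymm : ∀ᶠ z in nhds y, ∀ u v, G z u v = G z v u) (u v : E) :
    christoffel G y u v = christoffel G y v u := by
  change (G y).inverse (christoffelFirst G y u v) = (G y).inverse (christoffelFirst G y v u)
  congr 1
  ext w
  have : fderiv ℝ G y w u v = fderiv ℝ G y w v u := by
    rw [fderiv_bilinear_apply hG, fderiv_bilinear_apply hG]
    congr 1
    exact Filter.EventuallyEq.fderiv_eq (hsymm.mono fun z hz ↦ hz u v)
  rw [christoffelFirst_apply, christoffelFirst_apply, this]
  ring

theorem localRicci_apply (G : E → E →L[ℝ] E →L[ℝ] ℝ) (y v w : E) :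
    localRicci G y v w = LinearMap.trace ℝ E (curvatureEnd G y v w) :=
  rfl

theorem localRicci_congr {G G' : E → E →L[ℝ] E →L[ℝ] ℝ} {y : E} (h : G =ᶠ[nhds y] G') :
    localRicci G y = localRicci G' y := by
  have h1 : christoffel G =ᶠ[nhds y] christoffel G' :=
    h.eventuallyEq_nhds.mono fun z hz ↦ christoffel_congr hz
  ext v w
  rw [localRicci_apply, localRicci_apply]
  congr 1
  ext u
  rw [curvatureEnd_apply, curvatureEnd_apply, h1.fderiv_eq, h1.eq_of_nhds]

end LocalLemmas

/-! ### Christoffel symbols of a rescaled warped product. -/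

section WarpedForm

variable {E : Type*} [NormedAddCommGroup E] [NormedSpace ℝ E]
  {E' : Type*} [NormedAddCommGroup E'] [NormedSpace ℝ E']

/-- The function `f` has the `η`-gradient `F` and the Hessian `k η`. -/
structure HasScalarHessian (η : E →L[ℝ] E →L[ℝ] ℝ) (f : E → ℝ) (F : E → E) (k : ℝ) : Prop where
  hasFDerivAt : ∀ x, HasFDerivAt f (η (F x)) x
  hasFDerivAt_grad : ∀ x, HasFDerivAt F (k • ContinuousLinearMap.id ℝ E) x

theorem HasScalarHessian.contDiff {η : E →L[ℝ] E →L[ℝ] ℝ} {f : E → ℝ} {F : E → E} {k : ℝ}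
    (h : HasScalarHessian η f F k) : ContDiff ℝ ∞ f := by
  have hF : ContDiff ℝ ∞ F := by
    rw [contDiff_infty_iff_fderiv]
    refine ⟨fun x ↦ (h.hasFDerivAt_grad x).differentiableAt, ?_⟩
    rw [funext fun x ↦ (h.hasFDerivAt_grad x).fderiv]
    exact contDiff_const
  rw [contDiff_infty_iff_fderiv]
  refine ⟨fun x ↦ (h.hasFDerivAt x).differentiableAt, ?_⟩
  rw [funext fun x ↦ (h.hasFDerivAt x).fderiv]
  exact η.contDiff.comp hF

/-- Used with `c = 1` as the scale `s`, so that the unscaled warped product falls under the same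
formulas. -/
theorem hasScalarHessian_const (η : E →L[ℝ] E →L[ℝ] ℝ) (c : ℝ) :
    HasScalarHessian η (fun _ ↦ c) (fun _ ↦ 0) 0 where
  hasFDerivAt x := by simpa using hasFDerivAt_const c x
  hasFDerivAt_grad x := by simpa using hasFDerivAt_const (0 : E) x

/-- The metric `s⁻² (η ⊕ f² G)` on a product of coordinate domains. -/
def warpedForm (η : E →L[ℝ] E →L[ℝ] ℝ) (f s : E → ℝ) (G : E' → E' →L[ℝ] E' →L[ℝ] ℝ)
    (p : E × E') : (E × E') →L[ℝ] (E × E') →L[ℝ] ℝ :=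
  (s p.1 ^ 2)⁻¹ • blockForm η (f p.1 ^ 2 • G p.2)

theorem warpedForm_apply (η : E →L[ℝ] E →L[ℝ] ℝ) (f s : E → ℝ) (G : E' → E' →L[ℝ] E' →L[ℝ] ℝ)
    (p u v : E × E') : warpedForm η f s G p u v =
      (s p.1 ^ 2)⁻¹ * (η u.1 v.1 + f p.1 ^ 2 * G p.2 u.2 v.2) :=
  rfl

/-- The Christoffel symbols of `s⁻² (η ⊕ f² G)`, in terms of the `η`-gradients `F` of `f` and `S`
of `s`. -/
def warpedChristoffel (η : E →L[ℝ] E →L[ℝ] ℝ) (f s : E → ℝ) (F S : E → E)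
    (G : E' → E' →L[ℝ] E' →L[ℝ] ℝ) (p u v : E × E') : E × E' :=
  (((s p.1)⁻¹ * η u.1 v.1) • S p.1 - ((s p.1)⁻¹ * η (S p.1) u.1) • v.1
      - ((s p.1)⁻¹ * η (S p.1) v.1) • u.1
      - G p.2 u.2 v.2 • (f p.1 • F p.1 - (f p.1 ^ 2 * (s p.1)⁻¹) • S p.1),
    christoffel G p.2 u.2 v.2
      + ((f p.1)⁻¹ * η (F p.1) u.1 - (s p.1)⁻¹ * η (S p.1) u.1) • v.2
      + ((f p.1)⁻¹ * η (F p.1) v.1 - (s p.1)⁻¹ * η (S p.1) v.1) • u.2)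

variable [FiniteDimensional ℝ E']

theorem contDiff_blockForm (η : E →L[ℝ] E →L[ℝ] ℝ) {n : WithTop ℕ∞} :
    ContDiff ℝ n (fun θ : E' →L[ℝ] E' →L[ℝ] ℝ ↦ blockForm η θ) := by
  let L : (E' →L[ℝ] E' →L[ℝ] ℝ) →ₗ[ℝ] ((E × E') →L[ℝ] (E × E') →L[ℝ] ℝ) :=
    { toFun := fun θ ↦ θ.bilinearComp (.snd ℝ E E') (.snd ℝ E E')
      map_add' := fun _ _ ↦ rfl
      map_smul' := fun _ _ ↦ rfl }
  exact contDiff_const.add L.toContinuousLinearMap.contDiff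

theorem contDiffAt_warpedForm {n : WithTop ℕ∞} {η : E →L[ℝ] E →L[ℝ] ℝ} {f s : E → ℝ}
    {G : E' → E' →L[ℝ] E' →L[ℝ] ℝ} {p : E × E'} (hf : ContDiff ℝ n f) (hs : ContDiff ℝ n s)
    (hG : ContDiffAt ℝ n G p.2) (hsp : s p.1 ≠ 0) : ContDiffAt ℝ n (warpedForm η f s G) p := by
  have h1 : ContDiffAt ℝ n (fun p : E × E' ↦ f p.1 ^ 2 • G p.2) p :=
    ((hf.contDiffAt.comp p contDiffAt_fst).pow 2).smul (hG.comp p contDiffAt_snd)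
  have h2 : ContDiffAt ℝ n (fun p : E × E' ↦ (s p.1 ^ 2)⁻¹) p :=
    ((hs.contDiffAt.comp p contDiffAt_fst).pow 2).inv (pow_ne_zero 2 hsp)
  have h3 := (contDiff_blockForm (E := E) (E' := E') η (n := n)).contDiffAt.comp
    (f := fun p : E × E' ↦ f p.1 ^ 2 • G p.2) p h1
  exact h2.smul h3

variable {η : E →L[ℝ] E →L[ℝ] ℝ} {f s : E → ℝ} {F S : E → E} {k l : ℝ}
  {G : E' → E' →L[ℝ] E' →L[ℝ] ℝ} {p : E × E'}

theorem fderiv_warpedForm (hf : HasScalarHessian η f F k) (hs : HasScalarHessian η s S l)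
    (hG : ContDiffAt ℝ 1 G p.2) (hsp : s p.1 ≠ 0) (t u v : E × E') :
    fderiv ℝ (warpedForm η f s G) p t u v =
      -(2 * (s p.1)⁻¹ * (s p.1 ^ 2)⁻¹ * η (S p.1) t.1) * (η u.1 v.1 + f p.1 ^ 2 * G p.2 u.2 v.2)
      + (s p.1 ^ 2)⁻¹ * (2 * f p.1 * η (F p.1) t.1 * G p.2 u.2 v.2
        + f p.1 ^ 2 * fderiv ℝ G p.2 t.2 u.2 v.2) := by
  have hd := (contDiffAt_warpedForm (η := η) (hf.contDiff.of_le (by simp))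
    (hs.contDiff.of_le (by simp)) hG hsp).differentiableAt one_ne_zero
  refine (hasDerivAt_bilinear_line hd t u v).unique ?_
  have h1 := hasDerivAt_line (hs.hasFDerivAt p.1) t.1
  have h2 := hasDerivAt_line (hf.hasFDerivAt p.1) t.1
  have h3 := hasDerivAt_bilinear_line (hG.differentiableAt (by simp)) t.2 u.2 v.2
  have h4 := ((h1.pow 2).inv (by simpa using hsp)).mul
    (((h2.pow 2).mul h3).const_add (η u.1 v.1))
  refine h4.congr_deriv ?_
  simp
  field_simp

/-- Because `DF = k id` and `DS = l id`, differentiating the base data yields no new unknowns; only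
the derivatives of `G` and of its own Christoffel symbols appear. -/
theorem hasDerivAt_warpedChristoffel_line
    (hf : HasScalarHessian η f F k) (hs : HasScalarHessian η s S l)
    (hG : ContDiffAt ℝ ∞ G p.2) (hGp : (G p.2).IsInvertible)
    (hfp : f p.1 ≠ 0) (hsp : s p.1 ≠ 0) (t u v : E × E') :
    HasDerivAt (fun r : ℝ ↦ warpedChristoffel η f s F S G (p + r • t) u v)
    ((((s p.1)⁻¹ * l * η u.1 v.1) • t.1
        - ((s p.1)⁻¹ ^ 2 * η (S p.1) t.1 * η u.1 v.1) • S p.1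
        - ((s p.1)⁻¹ * l * η t.1 u.1 - (s p.1)⁻¹ ^ 2 * η (S p.1) t.1 * η (S p.1) u.1) • v.1
        - ((s p.1)⁻¹ * l * η t.1 v.1 - (s p.1)⁻¹ ^ 2 * η (S p.1) t.1 * η (S p.1) v.1) • u.1
        - fderiv ℝ G p.2 t.2 u.2 v.2 • (f p.1 • F p.1 - (f p.1 ^ 2 * (s p.1)⁻¹) • S p.1)
        - G p.2 u.2 v.2 • (η (F p.1) t.1 • F p.1 + (f p.1 * k) • t.1
          - (2 * f p.1 * η (F p.1) t.1 * (s p.1)⁻¹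
            - f p.1 ^ 2 * (s p.1)⁻¹ ^ 2 * η (S p.1) t.1) • S p.1
          - (f p.1 ^ 2 * (s p.1)⁻¹ * l) • t.1),
      fderiv ℝ (christoffel G) p.2 t.2 u.2 v.2
        + ((f p.1)⁻¹ * k * η t.1 u.1 - (f p.1)⁻¹ ^ 2 * η (F p.1) t.1 * η (F p.1) u.1
          - ((s p.1)⁻¹ * l * η t.1 u.1 - (s p.1)⁻¹ ^ 2 * η (S p.1) t.1 * η (S p.1) u.1)) • v.2
        + ((f p.1)⁻¹ * k * η t.1 v.1 - (f p.1)⁻¹ ^ 2 * η (F p.1) t.1 * η (F p.1) v.1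
          - ((s p.1)⁻¹ * l * η t.1 v.1 - (s p.1)⁻¹ ^ 2 * η (S p.1) t.1 * η (S p.1) v.1)) • u.2) :
        E × E') 0 := by
  have hsd := hasDerivAt_line (hs.hasFDerivAt p.1) t.1
  have hfd := hasDerivAt_line (hf.hasFDerivAt p.1) t.1
  have hSd := hasDerivAt_line (hs.hasFDerivAt_grad p.1) t.1
  have hFd := hasDerivAt_line (hf.hasFDerivAt_grad p.1) t.1
  have hsi := hsd.inv (by simpa using hsp)
  have hfi := hfd.inv (by simpa using hfp)
  have hSη (w : E) : HasDerivAt (fun r : ℝ ↦ η (S (p.1 + r • t.1)) w) (l * η t.1 w) 0 := by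
    have := (η.hasFDerivAt.comp_hasDerivAt (0 : ℝ) hSd).clm_apply (hasDerivAt_const 0 w)
    simpa using this
  have hFη (w : E) : HasDerivAt (fun r : ℝ ↦ η (F (p.1 + r • t.1)) w) (k * η t.1 w) 0 := by
    have := (η.hasFDerivAt.comp_hasDerivAt (0 : ℝ) hFd).clm_apply (hasDerivAt_const 0 w)
    simpa using this
  have hGd := hasDerivAt_bilinear_line (hG.differentiableAt (by simp)) t.2 u.2 v.2
  have hΓd := hasDerivAt_bilinear_line
    ((contDiffAt_christoffel hG hGp).differentiableAt (by simp)) t.2 u.2 v.2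
  refine HasDerivAt.prodMk ?_ ?_
  · refine (((((hsi.mul_const (η u.1 v.1)).smul hSd).sub ((hsi.mul (hSη u.1)).smul_const v.1)).sub
      ((hsi.mul (hSη v.1)).smul_const u.1)).sub
      (hGd.smul ((hfd.smul hFd).sub (((hfd.pow 2).mul hsi).smul hSd)))).congr_deriv ?_
    simp
    module
  · refine ((hΓd.add (((hfi.mul (hFη u.1)).sub (hsi.mul (hSη u.1))).smul_const v.2)).add
      (((hfi.mul (hFη v.1)).sub (hsi.mul (hSη v.1))).smul_const u.2)).congr_deriv ?_
    simp
    module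

variable [FiniteDimensional ℝ E]

theorem isInvertible_warpedForm (hη : η.IsInvertible) (hG : (G p.2).IsInvertible)
    (hf : f p.1 ≠ 0) (hs : s p.1 ≠ 0) : (warpedForm η f s G p).IsInvertible := by
  refine isInvertible_of_nondegenerate fun v hv ↦ ?_
  have hs' : (s p.1 ^ 2)⁻¹ ≠ 0 := inv_ne_zero (pow_ne_zero 2 hs)
  ext1
  · refine nondegenerate_of_isInvertible hη _ fun w ↦ ?_
    simpa [warpedForm_apply, hs] using hv (w, 0)
  · refine nondegenerate_of_isInvertible hG _ fun w ↦ ?_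
    simpa [warpedForm_apply, hs, hf] using hv (0, w)

theorem christoffel_warpedForm (hη : η.IsInvertible)
    (hf : HasScalarHessian η f F k) (hs : HasScalarHessian η s S l)
    (hG : ContDiffAt ℝ 1 G p.2) (hGp : (G p.2).IsInvertible)
    (hfp : f p.1 ≠ 0) (hsp : s p.1 ≠ 0) (u v : E × E') :
    christoffel (warpedForm η f s G) p u v = warpedChristoffel η f s F S G p u v := by
  refine christoffel_eq (isInvertible_warpedForm hη hGp hfp hsp) fun w ↦ ?_
  have h := apply_christoffel hGp u.2 v.2 w.2
  rw [christoffelFirst_apply] at h ⊢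
  rw [fderiv_warpedForm hf hs hG hsp, fderiv_warpedForm hf hs hG hsp,
    fderiv_warpedForm hf hs hG hsp, warpedForm_apply]
  simp only [warpedChristoffel, map_add, map_sub, map_smul, add_apply,
    sub_apply, smul_apply, smul_eq_mul, h]
  field_simp
  ring

theorem fderiv_christoffel_warpedForm (hη : η.IsInvertible)
    (hf : HasScalarHessian η f F k) (hs : HasScalarHessian η s S l)
    (hG : ContDiffAt ℝ ∞ G p.2) (hGp : (G p.2).IsInvertible)
    (hfp : f p.1 ≠ 0) (hsp : s p.1 ≠ 0) {t u v X : E × E'}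
    (h : HasDerivAt (fun r : ℝ ↦ warpedChristoffel η f s F S G (p + r • t) u v) X 0) :
    fderiv ℝ (christoffel (warpedForm η f s G)) p t u v = X := by
  have hd := (contDiffAt_christoffel
    (contDiffAt_warpedForm (η := η) hf.contDiff hs.contDiff hG hsp)
    (isInvertible_warpedForm hη hGp hfp hsp)).differentiableAt (by simp)
  refine (hasDerivAt_bilinear_line hd t u v).unique (h.congr_of_eventuallyEq ?_)
  -- All conditions behind the explicit formula are open, so it holds near `p` and may be
  -- differentiated.
  have hev : ∀ᶠ q in nhds p, christoffel (warpedForm η f s G) q u v =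
      warpedChristoffel η f s F S G q u v := by
    have h1 : ∀ᶠ q in nhds p, f q.1 ≠ 0 :=
      (hf.contDiff.continuous.comp continuous_fst).continuousAt.eventually_ne hfp
    have h2 : ∀ᶠ q in nhds p, s q.1 ≠ 0 :=
      (hs.contDiff.continuous.comp continuous_fst).continuousAt.eventually_ne hsp
    have h3 : ∀ᶠ q in nhds p, (G q.2).IsInvertible :=
      continuousAt_snd.eventually (eventually_isInvertible hG.continuousAt hGp)
    have h4 : ∀ᶠ q in nhds p, ContDiffAt ℝ 1 G q.2 :=
      continuousAt_snd.eventually ((hG.of_le (by simp)).eventually (by simp))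
    filter_upwards [h1, h2, h3, h4] with q h1 h2 h3 h4
    exact christoffel_warpedForm hη hf hs h4 h3 h1 h2 u v
  have hc : ContinuousAt (fun r : ℝ ↦ p + r • t) 0 := by fun_prop
  refine hc.eventually (p := fun q ↦ christoffel (warpedForm η f s G) q u v =
    warpedChristoffel η f s F S G q u v) ?_
  simpa using hev

end WarpedForm

/-! ### Ricci tensor by traces of diagonal blocks. -/

section WarpedRicci

variable {E : Type*} [NormedAddCommGroup E] [NormedSpace ℝ E] [FiniteDimensional ℝ E]
  {E' : Type*} [NormedAddCommGroup E'] [NormedSpace ℝ E'] [FiniteDimensional ℝ E']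

/-- Split the identity as `inl ∘ fst + inr ∘ snd` and use cyclicity of the trace. -/
theorem trace_eq_trace_add_trace (T : E × E' →ₗ[ℝ] E × E') :
    LinearMap.trace ℝ (E × E') T =
      LinearMap.trace ℝ E (LinearMap.fst ℝ E E' ∘ₗ T ∘ₗ LinearMap.inl ℝ E E') +
      LinearMap.trace ℝ E' (LinearMap.snd ℝ E E' ∘ₗ T ∘ₗ LinearMap.inr ℝ E E') := by
  have h : T = LinearMap.inl ℝ E E' ∘ₗ (LinearMap.fst ℝ E E' ∘ₗ T) +
      LinearMap.inr ℝ E E' ∘ₗ (LinearMap.snd ℝ E E' ∘ₗ T) := by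
    refine LinearMap.ext fun x ↦ ?_
    simp
  conv_lhs => rw [h, map_add, LinearMap.trace_comp_comm' _ (LinearMap.inl ℝ E E'),
    LinearMap.trace_comp_comm' _ (LinearMap.inr ℝ E E')]
  rfl

variable {η : E →L[ℝ] E →L[ℝ] ℝ} {f s : E → ℝ} {F S : E → E} {k l : ℝ}
  {G : E' → E' →L[ℝ] E' →L[ℝ] ℝ} {p : E × E'}

/-- With `u` tangent to the base, every derivative of `G` vanishes from the base component. What
remains is a multiple of the identity plus maps `u ↦ η(X,u) Y`, whose traces are `η(X,Y)`. -/
theorem fst_curvatureEnd_warpedForm_inl (hη : η.IsInvertible) (hηs : ∀ u v, η u v = η v u)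
    (hf : HasScalarHessian η f F k) (hs : HasScalarHessian η s S l)
    (hG : ContDiffAt ℝ ∞ G p.2) (hGp : (G p.2).IsInvertible)
    (hfp : f p.1 ≠ 0) (hsp : s p.1 ≠ 0) (v w : E × E') :
    LinearMap.fst ℝ E E' ∘ₗ curvatureEnd (warpedForm η f s G) p v w ∘ₗ LinearMap.inl ℝ E E' =
      (2 * (s p.1)⁻¹ * l * η v.1 w.1 - G p.2 v.2 w.2 * (f p.1 * k - f p.1 ^ 2 * (s p.1)⁻¹ * l)
        - 2 * (s p.1)⁻¹ ^ 2 * η (S p.1) v.1 * η (S p.1) w.1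
        - (s p.1)⁻¹ * η (S p.1) (warpedChristoffel η f s F S G p v w).1) • LinearMap.id
      - (η (S p.1) : E →ₗ[ℝ] ℝ).smulRight
        ((G p.2 v.2 w.2 * f p.1 ^ 2 * (s p.1)⁻¹ ^ 2) • S p.1
          + (s p.1)⁻¹ • (warpedChristoffel η f s F S G p v w).1
          + ((s p.1)⁻¹ ^ 2 * η (S p.1) v.1) • w.1 + ((s p.1)⁻¹ ^ 2 * η (S p.1) w.1) • v.1
          + ((s p.1)⁻¹ * G p.2 v.2 w.2) • (f p.1 • F p.1 - (f p.1 ^ 2 * (s p.1)⁻¹) • S p.1))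
      + (η (F p.1) : E →ₗ[ℝ] ℝ).smulRight
        (G p.2 v.2 w.2 • ((2 * f p.1 * (s p.1)⁻¹) • S p.1 - F p.1
          + (f p.1)⁻¹ • (f p.1 • F p.1 - (f p.1 ^ 2 * (s p.1)⁻¹) • S p.1)))
      + (η v.1 : E →ₗ[ℝ] ℝ).smulRight (((s p.1)⁻¹ ^ 2 * η (S p.1) w.1) • S p.1)
      + (η w.1 : E →ₗ[ℝ] ℝ).smulRight
        (((s p.1)⁻¹ ^ 2 * η (S p.1) v.1) • S p.1
          + ((s p.1)⁻¹ ^ 2 * η (S p.1) (S p.1) - 2 * (s p.1)⁻¹ * l) • v.1)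
      + (η (warpedChristoffel η f s F S G p v w).1 : E →ₗ[ℝ] ℝ).smulRight
        ((s p.1)⁻¹ • S p.1) := by
  refine LinearMap.ext fun u ↦ ?_
  change (curvatureEnd (warpedForm η f s G) p v w (u, 0)).1 = _
  have hG1 : ContDiffAt ℝ 1 G p.2 := hG.of_le (by simp)
  rw [curvatureEnd_apply,
    fderiv_christoffel_warpedForm hη hf hs hG hGp hfp hsp
      (hasDerivAt_warpedChristoffel_line hf hs hG hGp hfp hsp (u, 0) v w),
    fderiv_christoffel_warpedForm hη hf hs hG hGp hfp hsp
      (hasDerivAt_warpedChristoffel_line hf hs hG hGp hfp hsp v (u, 0) w)]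
  simp only [christoffel_warpedForm hη hf hs hG1 hGp hfp hsp]
  -- The inner symbol `Γ(v,w)` enters linearly and only through its base component, so it can stay
  -- opaque.
  generalize warpedChristoffel η f s F S G p v w = P
  simp only [warpedChristoffel, LinearMap.add_apply, LinearMap.sub_apply, LinearMap.smul_apply,
    LinearMap.smulRight_apply, LinearMap.id_apply, Prod.fst_add, Prod.fst_sub, map_zero,
    zero_apply, ContinuousLinearMap.coe_coe, map_add, map_sub, map_smul, smul_eq_mul]
  rw [hηs u w.1, hηs u v.1, hηs v.1 (S p.1), hηs u P.1]
  module

theorem snd_curvatureEnd_warpedForm_inr (hη : η.IsInvertible)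
    (hf : HasScalarHessian η f F k) (hs : HasScalarHessian η s S l)
    (hG : ContDiffAt ℝ ∞ G p.2) (hGp : (G p.2).IsInvertible)
    (hGs : ∀ᶠ z in nhds p.2, ∀ u v, G z u v = G z v u)
    (hfp : f p.1 ≠ 0) (hsp : s p.1 ≠ 0) (v w : E × E') :
    LinearMap.snd ℝ E E' ∘ₗ curvatureEnd (warpedForm η f s G) p v w ∘ₗ LinearMap.inr ℝ E E' =
      curvatureEnd G p.2 v.2 w.2
      + (((f p.1)⁻¹ * η (F p.1) (warpedChristoffel η f s F S G p v w).1
          - (s p.1)⁻¹ * η (S p.1) (warpedChristoffel η f s F S G p v w).1)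
        - ((f p.1)⁻¹ * k * η v.1 w.1 - (f p.1)⁻¹ ^ 2 * η (F p.1) v.1 * η (F p.1) w.1
          - ((s p.1)⁻¹ * l * η v.1 w.1 - (s p.1)⁻¹ ^ 2 * η (S p.1) v.1 * η (S p.1) w.1))
        - ((f p.1)⁻¹ * η (F p.1) v.1 - (s p.1)⁻¹ * η (S p.1) v.1)
          * ((f p.1)⁻¹ * η (F p.1) w.1 - (s p.1)⁻¹ * η (S p.1) w.1)) • LinearMap.id
      + (G p.2 w.2 : E' →ₗ[ℝ] ℝ).smulRight
        (((f p.1)⁻¹ * (f p.1 * η (F p.1) (F p.1) - f p.1 ^ 2 * (s p.1)⁻¹ * η (F p.1) (S p.1))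
          - (s p.1)⁻¹ * (f p.1 * η (S p.1) (F p.1)
            - f p.1 ^ 2 * (s p.1)⁻¹ * η (S p.1) (S p.1))) • v.2) := by
  refine LinearMap.ext fun u ↦ ?_
  change (curvatureEnd (warpedForm η f s G) p v w (0, u)).2 = _
  have hG1 : ContDiffAt ℝ 1 G p.2 := hG.of_le (by simp)
  have hsymm := christoffel_symm (hG1.differentiableAt one_ne_zero) hGs
  have h2 : (warpedChristoffel η f s F S G p v w).2 = christoffel G p.2 v.2 w.2
      + ((f p.1)⁻¹ * η (F p.1) v.1 - (s p.1)⁻¹ * η (S p.1) v.1) • w.2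
      + ((f p.1)⁻¹ * η (F p.1) w.1 - (s p.1)⁻¹ * η (S p.1) w.1) • v.2 := rfl
  rw [curvatureEnd_apply,
    fderiv_christoffel_warpedForm hη hf hs hG hGp hfp hsp
      (hasDerivAt_warpedChristoffel_line hf hs hG hGp hfp hsp (0, u) v w),
    fderiv_christoffel_warpedForm hη hf hs hG hGp hfp hsp
      (hasDerivAt_warpedChristoffel_line hf hs hG hGp hfp hsp v (0, u) w)]
  simp only [christoffel_warpedForm hη hf hs hG1 hGp hfp hsp]
  generalize warpedChristoffel η f s F S G p v w = P at h2 ⊢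
  simp only [warpedChristoffel, LinearMap.add_apply, LinearMap.smul_apply,
    LinearMap.smulRight_apply, LinearMap.id_apply, Prod.snd_add, Prod.snd_sub, map_zero,
    zero_apply, ContinuousLinearMap.coe_coe, map_add, map_sub, map_smul, smul_eq_mul, h2,
    curvatureEnd_apply]
  -- The fibre terms `Γ(u,v)` and `Γ(v,u)` cancel only because the fibre connection is torsion free.
  rw [hGs.self_of_nhds u w.2, hsymm u v.2]
  module

theorem localRicci_warpedForm (hη : η.IsInvertible) (hηs : ∀ u v, η u v = η v u)
    (hf : HasScalarHessian η f F k) (hs : HasScalarHessian η s S l)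
    (hG : ContDiffAt ℝ ∞ G p.2) (hGp : (G p.2).IsInvertible)
    (hGs : ∀ᶠ z in nhds p.2, ∀ u v, G z u v = G z v u)
    (hfp : f p.1 ≠ 0) (hsp : s p.1 ≠ 0) (v w : E × E') :
    localRicci (warpedForm η f s G) p v w =
      (-(finrank ℝ E' * k / f p.1) + (2 * finrank ℝ E + finrank ℝ E' - 2) * l / s p.1
        + finrank ℝ E' * η (F p.1) (S p.1) / (f p.1 * s p.1)
        - (finrank ℝ E + finrank ℝ E' - 1) * η (S p.1) (S p.1) / s p.1 ^ 2) * η v.1 w.1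
      + localRicci G p.2 v.2 w.2
      + (-(finrank ℝ E * k * f p.1) - (finrank ℝ E' - 1) * η (F p.1) (F p.1)
        + f p.1 ^ 2 * (finrank ℝ E * l / s p.1
          + (finrank ℝ E + 2 * finrank ℝ E' - 2) * η (F p.1) (S p.1) / (f p.1 * s p.1)
          - (finrank ℝ E + finrank ℝ E' - 1) * η (S p.1) (S p.1) / s p.1 ^ 2))
        * G p.2 v.2 w.2 := by
  rw [localRicci_apply, trace_eq_trace_add_trace,
    fst_curvatureEnd_warpedForm_inl hη hηs hf hs hG hGp hfp hsp,
    snd_curvatureEnd_warpedForm_inr hη hf hs hG hGp hGs hfp hsp, localRicci_apply]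
  have h1 : (warpedChristoffel η f s F S G p v w).1 = ((s p.1)⁻¹ * η v.1 w.1) • S p.1
      - ((s p.1)⁻¹ * η (S p.1) v.1) • w.1 - ((s p.1)⁻¹ * η (S p.1) w.1) • v.1
      - G p.2 v.2 w.2 • (f p.1 • F p.1 - (f p.1 ^ 2 * (s p.1)⁻¹) • S p.1) := rfl
  simp only [map_add, map_sub, map_smul, LinearMap.trace_smulRight, LinearMap.trace_id, h1,
    ContinuousLinearMap.coe_coe, smul_eq_mul, sub_apply, smul_apply]
  rw [hηs v.1 (S p.1), hηs w.1 (S p.1), hηs w.1 v.1, hGs.self_of_nhds w.2 v.2,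
    hηs (S p.1) (F p.1)]
  field_simp
  ring

end WarpedRicci

/-! ### Traces with respect to the metric. -/

section MetricTrace

variable {E : Type*} [NormedAddCommGroup E] [NormedSpace ℝ E]
  {E' : Type*} [NormedAddCommGroup E'] [NormedSpace ℝ E']

theorem metricTrace_eq_trace {g B : E →L[ℝ] E →L[ℝ] ℝ} {T : E →L[ℝ] E} (hg : g.IsInvertible)
    (h : B = g ∘L T) : metricTrace g B = LinearMap.trace ℝ E T := by
  have : g.inverse ∘L B = T := by
    rw [h, ← ContinuousLinearMap.comp_assoc, hg.inverse_comp_self, ContinuousLinearMap.id_comp]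
  rw [metricTrace, this]

variable [FiniteDimensional ℝ E] [FiniteDimensional ℝ E']

theorem traceFreePart_smul_self {g : E →L[ℝ] E →L[ℝ] ℝ} (hg : g.IsInvertible)
    (hE : (finrank ℝ E : ℝ) ≠ 0) (c : ℝ) : traceFreePart g (c • g) = 0 := by
  have h : metricTrace g (c • g) = c * finrank ℝ E := by
    rw [metricTrace_eq_trace (T := c • ContinuousLinearMap.id ℝ E) hg (by ext; simp)]
    change LinearMap.trace ℝ E (c • LinearMap.id) = _
    rw [map_smul, LinearMap.trace_id, smul_eq_mul]
  rw [traceFreePart, h, mul_comm c, inv_mul_cancel_left₀ hE, sub_self]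

/-- Raising an index makes such a form act by the scalar `s² c` on the base and `s² d / f²` on the
fibre. -/
theorem metricTrace_warpedForm {η : E →L[ℝ] E →L[ℝ] ℝ} {f s : E → ℝ}
    {G : E' → E' →L[ℝ] E' →L[ℝ] ℝ} {p : E × E'} (hη : η.IsInvertible) (hG : (G p.2).IsInvertible)
    (hf : f p.1 ≠ 0) (hs : s p.1 ≠ 0) (c d : ℝ) {B : (E × E') →L[ℝ] (E × E') →L[ℝ] ℝ}
    (hB : ∀ v w, B v w = c * η v.1 w.1 + d * G p.2 v.2 w.2) :
    metricTrace (warpedForm η f s G p) B =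
      s p.1 ^ 2 * (c * finrank ℝ E + d / f p.1 ^ 2 * finrank ℝ E') := by
  let T : E × E' →L[ℝ] E × E' := ContinuousLinearMap.prodMap
    ((s p.1 ^ 2 * c) • ContinuousLinearMap.id ℝ E)
    ((s p.1 ^ 2 * (d / f p.1 ^ 2)) • ContinuousLinearMap.id ℝ E')
  have hT : B = warpedForm η f s G p ∘L T := by
    refine ContinuousLinearMap.ext fun v ↦ ContinuousLinearMap.ext fun w ↦ ?_
    rw [hB, ContinuousLinearMap.comp_apply, warpedForm_apply]
    simp [T]
    field_simp
  rw [metricTrace_eq_trace (isInvertible_warpedForm hη hG hf hs) hT]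
  change LinearMap.trace ℝ (E × E') (LinearMap.prodMap ((s p.1 ^ 2 * c) • LinearMap.id)
    ((s p.1 ^ 2 * (d / f p.1 ^ 2)) • LinearMap.id)) = _
  rw [LinearMap.trace_prodMap', map_smul, map_smul, LinearMap.trace_id, LinearMap.trace_id]
  simp only [smul_eq_mul]
  ring

end MetricTrace

/-! ### Hessian of a function on the base. -/

section WarpedHessian

variable {E : Type*} [NormedAddCommGroup E] [NormedSpace ℝ E] [FiniteDimensional ℝ E]
  {E' : Type*} [NormedAddCommGroup E'] [NormedSpace ℝ E'] [FiniteDimensional ℝ E']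
  {η : E →L[ℝ] E →L[ℝ] ℝ} {f s : E → ℝ} {F S : E → E} {k l : ℝ}
  {G : E' → E' →L[ℝ] E' →L[ℝ] ℝ} {p : E × E'}

/-- The differential of `s` sees only the base component of the Christoffel symbols, which for scale
`1` is `-f G(v,w) F`. -/
theorem localHessian_warpedForm (hη : η.IsInvertible)
    (hf : HasScalarHessian η f F k) (hs : HasScalarHessian η s S l)
    (hG : ContDiffAt ℝ ∞ G p.2) (hGp : (G p.2).IsInvertible) (hfp : f p.1 ≠ 0)
    (v w : E × E') :
    localHessian (warpedForm η f (fun _ ↦ 1) G) (fun q ↦ s q.1) p v w =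
      l * η v.1 w.1 + f p.1 * η (S p.1) (F p.1) * G p.2 v.2 w.2 := by
  have h1 (q : E × E') : HasFDerivAt (fun q : E × E' ↦ s q.1)
      (η (S q.1) ∘L ContinuousLinearMap.fst ℝ E E') q :=
    (hs.hasFDerivAt q.1).comp q hasFDerivAt_fst
  have h2 : fderiv ℝ (fderiv ℝ (fun q : E × E' ↦ s q.1)) p v w = l * η v.1 w.1 := by
    rw [funext fun q ↦ (h1 q).fderiv]
    have h3 : HasFDerivAt (fun q : E × E' ↦ η (S q.1))
        (η ∘L (l • ContinuousLinearMap.id ℝ E) ∘L ContinuousLinearMap.fst ℝ E E') p :=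
      η.hasFDerivAt.comp p ((hs.hasFDerivAt_grad p.1).comp p hasFDerivAt_fst)
    rw [(h3.clm_comp (hasFDerivAt_const _ p)).fderiv]
    simp
  rw [localHessian_apply, h2, (h1 p).fderiv, christoffel_warpedForm hη hf
    (hasScalarHessian_const η 1) (hG.of_le (by simp)) hGp hfp one_ne_zero]
  simp [warpedChristoffel]
  ring

end WarpedHessian

/-! ### The pseudo-Euclidean base and its quadratic functions. -/

section FlatForm

variable {m : ℕ} {ε : Fin m → ℝ}

theorem flatForm_symm (ε : Fin m → ℝ) (u v : EuclideanSpace ℝ (Fin m)) :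
    flatForm ε u v = flatForm ε v u := by
  simp only [flatForm_apply, mul_comm]

theorem isInvertible_flatForm (hε : ∀ i, ε i = 1 ∨ ε i = -1) : (flatForm ε).IsInvertible := by
  refine isInvertible_of_nondegenerate fun v hv ↦ ?_
  ext i
  have h := hv (EuclideanSpace.single i 1)
  rw [flatForm_apply, Finset.sum_eq_single i (by intro j _ hj; simp [hj]) (by simp)] at h
  rcases hε i with h1 | h1 <;> simpa [h1] using h

theorem flatForm_self (ε : Fin m → ℝ) (x : EuclideanSpace ℝ (Fin m)) :
    flatForm ε x x = normSq ε x := by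
  simp only [flatForm_apply, normSq, sq]

/-- The vector `εᵢ cᵢ` which represents the covector `c` in the flat metric. -/
def flatSharp (ε : Fin m → ℝ) (c : EuclideanSpace ℝ (Fin m)) : EuclideanSpace ℝ (Fin m) :=
  WithLp.toLp 2 fun i ↦ ε i * c i

theorem flatForm_flatSharp (hε : ∀ i, ε i = 1 ∨ ε i = -1) (c x : EuclideanSpace ℝ (Fin m)) :
    flatForm ε (flatSharp ε c) x = ∑ i, c i * x i := by
  rw [flatForm_apply]
  refine Finset.sum_congr rfl fun i _ ↦ ?_
  change ε i * (ε i * c i * x i) = _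
  rcases hε i with h | h <;> rw [h] <;> ring

theorem sum_mul_flatSharp (ε : Fin m → ℝ) (c : EuclideanSpace ℝ (Fin m)) :
    ∑ i, c i * flatSharp ε c i = normSq ε c := by
  refine Finset.sum_congr rfl fun i _ ↦ ?_
  change c i * (ε i * c i) = _
  ring

theorem hasScalarHessian_flatForm (hε : ∀ i, ε i = 1 ∨ ε i = -1) (A B : ℝ)
    (c : EuclideanSpace ℝ (Fin m)) :
    HasScalarHessian (flatForm ε) (fun x ↦ A + B * normSq ε x + ∑ i, c i * x i)
      (fun x ↦ (2 * B) • x + flatSharp ε c) (2 * B) where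
  hasFDerivAt x := by
    have h1 : HasFDerivAt (fun x ↦ flatForm ε x x)
        (flatForm ε x + (flatForm ε).flip x) x := by
      have := (flatForm ε).hasFDerivAt (x := x).clm_apply (hasFDerivAt_id x)
      refine this.congr_fderiv ?_
      ext w
      simp
    have h2 := ((h1.const_mul B).const_add A).add (flatForm ε (flatSharp ε c)).hasFDerivAt
    have h3 : HasFDerivAt
        (fun x ↦ A + B * flatForm ε x x + flatForm ε (flatSharp ε c) x) _ x := h2
    simp only [flatForm_self, flatForm_flatSharp hε] at h3
    refine h3.congr_fderiv ?_
    ext w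
    simp [flatForm_symm ε w x]
    ring
  hasFDerivAt_grad x := by
    exact ((2 * B) • ContinuousLinearMap.id ℝ _).hasFDerivAt.add_const _

end FlatForm

section ExtChart

variable {m : ℕ} {E' : Type*} [NormedAddCommGroup E'] [NormedSpace ℝ E']
  {H' : Type*} [TopologicalSpace H'] {I' : ModelWithCorners ℝ E' H'}
  {N : Type*} [TopologicalSpace N] [ChartedSpace H' N]

theorem extChartAt_euclidean_prod (p : EuclideanSpace ℝ (Fin m) × N) :
    extChartAt ((𝓡 m).prod I') p p = (p.1, extChartAt I' p.2 p.2) := by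
  rw [extChartAt_prod]
  rfl

end ExtChart

/-! ### Transfer of the local formulas to the manifold. -/

section ConformalWarpedProduct

variable {m : ℕ} {ε : Fin m → ℝ}
  {E' : Type*} [NormedAddCommGroup E'] [NormedSpace ℝ E'] [FiniteDimensional ℝ E']
  {H' : Type*} [TopologicalSpace H'] {I' : ModelWithCorners ℝ E' H'}
  {N : Type*} [TopologicalSpace N] [ChartedSpace H' N]

/-- The metric `s⁻² (g ⊕ f² g')` with `g` the flat metric and a function `s` on the base. -/
def conformalWarpedProduct (ε : Fin m → ℝ) (gN : FormField I' N)
    (f s : EuclideanSpace ℝ (Fin m) → ℝ) :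
    FormField ((𝓡 m).prod I') (EuclideanSpace ℝ (Fin m) × N) :=
  fun p ↦ (s p.1 ^ 2)⁻¹ • warpedProduct (flatMetric ε) gN f p

theorem conformalWarpedProduct_one (ε : Fin m → ℝ) (gN : FormField I' N)
    (f : EuclideanSpace ℝ (Fin m) → ℝ) :
    conformalWarpedProduct ε gN f (fun _ ↦ 1) = warpedProduct (flatMetric ε) gN f := by
  funext p
  simp [conformalWarpedProduct]

theorem IsMetricOn.coordMetric_symm {gN : FormField I' N} [IsManifold I' 1 N]
    (hN : IsMetricOn gN Set.univ) (q : N)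
    (y u v : E') : coordMetric gN q y u v = coordMetric gN q y v u :=
  hN.symm _ trivial _ _

variable [I'.Boundaryless]

theorem IsMetricOn.isInvertible_coordMetric {gN : FormField I' N} [IsManifold I' 1 N]
    (hN : IsMetricOn gN Set.univ) (q : N) :
    (coordMetric gN q (extChartAt I' q q)).IsInvertible := by
  rw [coordMetric_self]
  exact isInvertible_of_nondegenerate (E := E') (hN.nondegenerate q trivial)

variable [IsManifold I' ∞ N]

theorem IsMetricOn.contDiffAt_coordMetric {gN : FormField I' N}
    (hN : IsMetricOn gN Set.univ) (q : N) :
    ContDiffAt ℝ ∞ (coordMetric gN q) (extChartAt I' q q) :=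
  (contMDiffAt_form_iff gN q).1 (hN.contMDiffOn.contMDiffAt Filter.univ_mem)

theorem coordMetric_conformalWarpedProduct (gN : FormField I' N)
    (f s : EuclideanSpace ℝ (Fin m) → ℝ) (p : EuclideanSpace ℝ (Fin m) × N) :
    coordMetric (conformalWarpedProduct ε gN f s) p
      =ᶠ[nhds (p.1, extChartAt I' p.2 p.2)]
      warpedForm (flatForm ε) f s (coordMetric gN p.2) := by
  have h : ∀ᶠ q : EuclideanSpace ℝ (Fin m) × E' in nhds (p.1, extChartAt I' p.2 p.2),
      q.2 ∈ (extChartAt I' p.2).target :=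
    continuousAt_snd.eventually (extChartAt_target_mem_nhds p.2)
  filter_upwards [h] with q hq
  unfold conformalWarpedProduct
  rw [coordMetric_smul, coordMetric_warpedProduct _ _ _ _
    (by rw [extChartAt_model_space_eq_id]; trivial) hq, coordMetric_flatMetric, extChartAt_prod]
  rfl

variable {gN : FormField I' N} {f s : EuclideanSpace ℝ (Fin m) → ℝ}
  {F S : EuclideanSpace ℝ (Fin m) → EuclideanSpace ℝ (Fin m)} {k l : ℝ}

theorem conformalWarpedProduct_eq_warpedForm (gN : FormField I' N)
    (f s : EuclideanSpace ℝ (Fin m) → ℝ) (p : EuclideanSpace ℝ (Fin m) × N) :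
    conformalWarpedProduct ε gN f s p =
      warpedForm (flatForm ε) f s (coordMetric gN p.2) (p.1, extChartAt I' p.2 p.2) := by
  rw [← (coordMetric_conformalWarpedProduct gN f s p).eq_of_nhds, ← extChartAt_euclidean_prod,
    coordMetric_self]

theorem isMetricOn_conformalWarpedProduct
    (hε : ∀ i, ε i = 1 ∨ ε i = -1) (hN : IsMetricOn gN Set.univ)
    (hf : ContDiff ℝ ∞ f) (hs : ContDiff ℝ ∞ s) :
    IsMetricOn (conformalWarpedProduct ε gN f s) {p | f p.1 ≠ 0 ∧ s p.1 ≠ 0} where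
  isOpen := ((hf.continuous.comp continuous_fst).isOpen_preimage _ isOpen_compl_singleton).inter
    ((hs.continuous.comp continuous_fst).isOpen_preimage _ isOpen_compl_singleton)
  symm p _ v w := by
    rw [conformalWarpedProduct_eq_warpedForm]
    change warpedForm _ _ _ _ _ (show EuclideanSpace ℝ (Fin m) × E' from v)
      (show EuclideanSpace ℝ (Fin m) × E' from w) = warpedForm _ _ _ _ _
      (show EuclideanSpace ℝ (Fin m) × E' from w) (show EuclideanSpace ℝ (Fin m) × E' from v)
    rw [warpedForm_apply, warpedForm_apply, flatForm_symm, hN.coordMetric_symm]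
  nondegenerate p hp v hv := by
    rw [conformalWarpedProduct_eq_warpedForm] at hv
    exact nondegenerate_of_isInvertible (E := EuclideanSpace ℝ (Fin m) × E')
      (isInvertible_warpedForm (isInvertible_flatForm hε) (hN.isInvertible_coordMetric p.2)
        hp.1 hp.2) v hv
  contMDiffOn p hp := by
    refine ContMDiffAt.contMDiffWithinAt ((contMDiffAt_form_iff _ p).2 ?_)
    rw [extChartAt_euclidean_prod]
    have h := contDiffAt_warpedForm (p := (p.1, extChartAt I' p.2 p.2)) (η := flatForm ε) hf hs
      (hN.contDiffAt_coordMetric p.2) hp.2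
    exact h.congr_of_eventuallyEq
      (coordMetric_conformalWarpedProduct gN f s p)

theorem ricci_conformalWarpedProduct
    (hε : ∀ i, ε i = 1 ∨ ε i = -1) (hN : IsMetricOn gN Set.univ) {c : ℝ}
    {p : EuclideanSpace ℝ (Fin m) × N} (hc : ricci gN p.2 = c • gN p.2)
    (hf : HasScalarHessian (flatForm ε) f F k) (hs : HasScalarHessian (flatForm ε) s S l)
    (hfp : f p.1 ≠ 0) (hsp : s p.1 ≠ 0) (v w : EuclideanSpace ℝ (Fin m) × E') :
    (show (EuclideanSpace ℝ (Fin m) × E') →L[ℝ] (EuclideanSpace ℝ (Fin m) × E') →L[ℝ] ℝ from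
      ricci (conformalWarpedProduct ε gN f s) p) v w =
      (-(finrank ℝ E' * k / f p.1) + (2 * m + finrank ℝ E' - 2) * l / s p.1
        + finrank ℝ E' * flatForm ε (F p.1) (S p.1) / (f p.1 * s p.1)
        - (m + finrank ℝ E' - 1) * flatForm ε (S p.1) (S p.1) / s p.1 ^ 2)
        * flatForm ε v.1 w.1
      + (c - m * k * f p.1 - (finrank ℝ E' - 1) * flatForm ε (F p.1) (F p.1)
        + f p.1 ^ 2 * (m * l / s p.1
          + (m + 2 * finrank ℝ E' - 2) * flatForm ε (F p.1) (S p.1) / (f p.1 * s p.1)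
          - (m + finrank ℝ E' - 1) * flatForm ε (S p.1) (S p.1) / s p.1 ^ 2))
        * coordMetric gN p.2 (extChartAt I' p.2 p.2) v.2 w.2 := by
  change localRicci (coordMetric (conformalWarpedProduct ε gN f s) p)
    (extChartAt ((𝓡 m).prod I') p p) v w = _
  rw [extChartAt_euclidean_prod, localRicci_congr (coordMetric_conformalWarpedProduct gN f s p)]
  have h1 := localRicci_warpedForm (p := (p.1, extChartAt I' p.2 p.2)) (isInvertible_flatForm hε)
    (flatForm_symm ε) hf hs (hN.contDiffAt_coordMetric p.2) (hN.isInvertible_coordMetric p.2)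
    (Filter.Eventually.of_forall (hN.coordMetric_symm p.2)) hfp hsp v w
  have h2 : localRicci (coordMetric gN p.2) (extChartAt I' p.2 p.2) v.2 w.2 =
      c * coordMetric gN p.2 (extChartAt I' p.2 p.2) v.2 w.2 := by
    change ricci gN p.2 v.2 w.2 = _
    rw [hc, coordMetric_self]
    rfl
  rw [h2, finrank_euclideanSpace_fin] at h1
  rw [h1]
  ring

end ConformalWarpedProduct

/-! ### Four-dimensional Einstein fibre. -/

section EinsteinFibre

variable {m : ℕ} {ε : Fin m → ℝ}
  {N : Type*} [TopologicalSpace N] [ChartedSpace (EuclideanSpace ℝ (Fin 4)) N]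
  [IsManifold (𝓡 4) ∞ N] {gN : FormField (𝓡 4) N} {f s : EuclideanSpace ℝ (Fin m) → ℝ}
  {F S : EuclideanSpace ℝ (Fin m) → EuclideanSpace ℝ (Fin m)} {k l c : ℝ}
  {p : EuclideanSpace ℝ (Fin m) × N}

theorem scalarCurvature_conformalWarpedProduct
    (hε : ∀ i, ε i = 1 ∨ ε i = -1) (hN : IsMetricOn gN Set.univ)
    (hc : ricci gN p.2 = c • gN p.2)
    (hf : HasScalarHessian (flatForm ε) f F k) (hs : HasScalarHessian (flatForm ε) s S l)
    (hfp : f p.1 ≠ 0) (hsp : s p.1 ≠ 0) :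
    scalarCurvature (conformalWarpedProduct ε gN f s) p =
      s p.1 ^ 2 * ((4 * c - 12 * flatForm ε (F p.1) (F p.1)) / f p.1 ^ 2 - 8 * m * k / f p.1)
      + 2 * (m + 3) * s p.1 * (m * l + 4 * flatForm ε (F p.1) (S p.1) / f p.1)
      - (m + 4) * (m + 3) * flatForm ε (S p.1) (S p.1) := by
  unfold scalarCurvature
  rw [conformalWarpedProduct_eq_warpedForm]
  have h := metricTrace_warpedForm (p := (p.1, extChartAt (𝓡 4) p.2 p.2))
    (isInvertible_flatForm hε) (hN.isInvertible_coordMetric p.2) hfp hsp _ _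
    (ricci_conformalWarpedProduct hε hN hc hf hs hfp hsp)
  refine h.trans ?_
  simp only [finrank_euclideanSpace_fin]
  push_cast
  field_simp
  ring

theorem hessian_conformalWarpedProduct_one
    (hε : ∀ i, ε i = 1 ∨ ε i = -1) (hN : IsMetricOn gN Set.univ)
    (hf : HasScalarHessian (flatForm ε) f F k) (hs : HasScalarHessian (flatForm ε) s S l)
    (hfp : f p.1 ≠ 0) (v w : EuclideanSpace ℝ (Fin m) × EuclideanSpace ℝ (Fin 4)) :
    (show (EuclideanSpace ℝ (Fin m) × EuclideanSpace ℝ (Fin 4)) →L[ℝ]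
        (EuclideanSpace ℝ (Fin m) × EuclideanSpace ℝ (Fin 4)) →L[ℝ] ℝ from
      hessian (conformalWarpedProduct ε gN f (fun _ ↦ 1)) (fun q ↦ s q.1) p) v w =
      l * flatForm ε v.1 w.1 + f p.1 * flatForm ε (S p.1) (F p.1)
        * coordMetric gN p.2 (extChartAt (𝓡 4) p.2 p.2) v.2 w.2 := by
  have h := localHessian_warpedForm (p := (p.1, extChartAt (𝓡 4) p.2 p.2))
    (isInvertible_flatForm hε) hf hs (hN.contDiffAt_coordMetric p.2)
    (hN.isInvertible_coordMetric p.2) hfp v w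
  refine Eq.trans ?_ h
  change localHessian (coordMetric (conformalWarpedProduct ε gN f _) p) _
    (extChartAt ((𝓡 m).prod (𝓡 4)) p p) v w = _
  rw [extChartAt_euclidean_prod]
  refine DFunLike.congr_fun (DFunLike.congr_fun (localHessian_congr
    (coordMetric_conformalWarpedProduct gN f _ p) (Filter.Eventually.of_forall fun q ↦ ?_)) v) w
  rw [extChartAt_prod]
  rfl

/-- By `hcF`, `Ric = -(8b/f) η - (12 + 2m) b f G` and `Sc = -16 b (m+3)/f`. The base parts cancel in
the Schouten tensor, and `hFS` makes the fibre part of the sum equal to `l f² G`. -/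
theorem hessian_add_smul_schouten_conformalWarpedProduct_one
    (hε : ∀ i, ε i = 1 ∨ ε i = -1) (hN : IsMetricOn gN Set.univ) {b : ℝ}
    (hc : ricci gN p.2 = c • gN p.2)
    (hf : HasScalarHessian (flatForm ε) f F (2 * b)) (hs : HasScalarHessian (flatForm ε) s S l)
    (hfp : f p.1 ≠ 0) (hcF : c - 3 * flatForm ε (F p.1) (F p.1) = -12 * b * f p.1)
    (hFS : flatForm ε (S p.1) (F p.1) = l * f p.1 + 2 * b * s p.1) :
    hessian (conformalWarpedProduct ε gN f (fun _ ↦ 1)) (fun q ↦ s q.1) p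
      + s p.1 • schouten (conformalWarpedProduct ε gN f (fun _ ↦ 1)) p =
      l • conformalWarpedProduct ε gN f (fun _ ↦ 1) p := by
  have h1 := hasScalarHessian_const (flatForm ε) 1
  have hSc := scalarCurvature_conformalWarpedProduct hε hN hc hf h1 hfp one_ne_zero
  have hRic := ricci_conformalWarpedProduct hε hN hc hf h1 hfp one_ne_zero
  have hHess := hessian_conformalWarpedProduct_one hε hN hf hs hfp
  have hg := conformalWarpedProduct_eq_warpedForm (ε := ε) gN f (fun _ ↦ 1) p
  refine ContinuousLinearMap.ext fun (v : EuclideanSpace ℝ (Fin m) × EuclideanSpace ℝ (Fin 4)) ↦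
    ContinuousLinearMap.ext fun (w : EuclideanSpace ℝ (Fin m) × EuclideanSpace ℝ (Fin 4)) ↦ ?_
  have hgv := (DFunLike.congr_fun (DFunLike.congr_fun hg v) w).trans (warpedForm_apply ..)
  -- The term follows the definition of `∇∇s + s P` and replaces each constituent by its explicit
  -- value at `(v, w)`.
  refine (congrArg₂ (· + ·) (hHess v w) (congrArg (s p.1 * ·) (congrArg (_⁻¹ * ·)
    (congrArg₂ (· - ·) (hRic v w) (congrArg₂ (· * ·) (congrArg (· / _) hSc) hgv))))).trans
    (Eq.trans ?_ (congrArg (l * ·) hgv).symm)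
  have hdim : (finrank ℝ (EuclideanSpace ℝ (Fin m) × EuclideanSpace ℝ (Fin 4)) : ℝ) = m + 4 := by
    rw [finrank_prod, finrank_euclideanSpace_fin, finrank_euclideanSpace_fin]
    push_cast
    rfl
  have hm2 : (m : ℝ) + 4 - 2 ≠ 0 := by
    exact ne_of_gt (by linarith [m.cast_nonneg (α := ℝ)])
  have hm1 : (m : ℝ) + 4 - 1 ≠ 0 := by
    exact ne_of_gt (by linarith [m.cast_nonneg (α := ℝ)])
  obtain rfl : c = -12 * b * f p.1 + 3 * flatForm ε (F p.1) (F p.1) := by linarith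
  simp only [hdim, hFS, finrank_euclideanSpace_fin, map_zero]
  push_cast
  field_simp
  ring

end EinsteinFibre

/-! ### The quadratic functions `f` and `σ`. -/

theorem hasScalarHessian_const_add_normSq {m : ℕ} {ε : Fin m → ℝ} (hε : ∀ i, ε i = 1 ∨ ε i = -1)
    (a b : ℝ) :
    HasScalarHessian (flatForm ε) (fun x ↦ a + b * normSq ε x) (fun x ↦ (2 * b) • x) (2 * b) := by
  have h : flatSharp ε 0 = 0 := by ext i; simp [flatSharp]
  simpa [h] using hasScalarHessian_flatForm hε a b 0

end SemiRiem

end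
theorem mainTheorem5 {N : Type*} [TopologicalSpace N] [ChartedSpace (EuclideanSpace ℝ (Fin 4)) N]
    [IsManifold (𝓡 4) ∞ N] (gN : SemiRiem.FormField (𝓡 4) N)
    (n m : ℕ) (hn : n = m + 4)
    (ε : Fin m → ℝ) (hε : ∀ i, ε i = 1 ∨ ε i = -1)
    (a b A B : ℝ) (c : EuclideanSpace ℝ (Fin m))
    (hEinstein : SemiRiem.IsEinstein gN)
    (hSc : ∀ q, SemiRiem.scalarCurvature gN q = -48 * a * b)
    (haB : a * B = -(b * A))
    (f : EuclideanSpace ℝ (Fin m) → ℝ) (hf : ∀ x, f x = a + b * SemiRiem.normSq ε x)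
    (σ : EuclideanSpace ℝ (Fin m) × N → ℝ)
    (hσ : ∀ p, σ p = A + B * SemiRiem.normSq ε p.1 + ∑ i, c i * p.1 i)
    (g : SemiRiem.FormField ((𝓡 m).prod (𝓡 4)) (EuclideanSpace ℝ (Fin m) × N))
    (hg : g = SemiRiem.warpedProduct (SemiRiem.flatMetric ε) gN f) :
    SemiRiem.IsMetricOn g {p | f p.1 ≠ 0} ∧
    SemiRiem.IsAlmostEinsteinScaleOn g σ {p | f p.1 ≠ 0} ∧
    SemiRiem.IsMetricOn (fun p ↦ (σ p ^ 2)⁻¹ • g p) {p | f p.1 ≠ 0 ∧ σ p ≠ 0} ∧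
    ∀ p, f p.1 ≠ 0 → σ p ≠ 0 →
      SemiRiem.scalarCurvature (fun p ↦ (σ p ^ 2)⁻¹ • g p) p =
        n * (n - 1) * (4 * A * B - SemiRiem.normSq ε c) := by
  obtain rfl : f = fun x ↦ a + b * SemiRiem.normSq ε x := funext hf
  have hf' := SemiRiem.hasScalarHessian_const_add_normSq hε a b
  obtain ⟨s, hs⟩ : ∃ s : EuclideanSpace ℝ (Fin m) → ℝ,
      s = fun x ↦ A + B * SemiRiem.normSq ε x + ∑ i, c i * x i := ⟨_, rfl⟩
  have hs' := SemiRiem.hasScalarHessian_flatForm hε A B c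
  rw [← hs] at hs'
  obtain rfl : σ = fun p ↦ s p.1 := funext fun p ↦ by rw [hσ, hs]
  have hsx (x : EuclideanSpace ℝ (Fin m)) :
      s x = A + B * SemiRiem.normSq ε x + ∑ i, c i * x i := by rw [hs]
  have hFF (x : EuclideanSpace ℝ (Fin m)) :
      SemiRiem.flatForm ε ((2 * b) • x) ((2 * b) • x) = 4 * b ^ 2 * SemiRiem.normSq ε x := by
    simp only [map_smul, smul_apply, smul_eq_mul, SemiRiem.flatForm_self]
    ring
  have hSF (x : EuclideanSpace ℝ (Fin m)) :
      SemiRiem.flatForm ε ((2 * B) • x + SemiRiem.flatSharp ε c) ((2 * b) • x) =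
        4 * b * B * SemiRiem.normSq ε x + 2 * b * ∑ i, c i * x i := by
    simp only [map_smul, map_add, add_apply, smul_apply, smul_eq_mul, SemiRiem.flatForm_self,
      SemiRiem.flatForm_flatSharp hε]
    ring
  have hSS (x : EuclideanSpace ℝ (Fin m)) :
      SemiRiem.flatForm ε ((2 * B) • x + SemiRiem.flatSharp ε c)
        ((2 * B) • x + SemiRiem.flatSharp ε c) =
        4 * B ^ 2 * SemiRiem.normSq ε x + 4 * B * (∑ i, c i * x i) + SemiRiem.normSq ε c := by
    simp only [map_smul, map_add, add_apply, smul_apply, smul_eq_mul, SemiRiem.flatForm_self,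
      SemiRiem.flatForm_symm ε x, SemiRiem.flatForm_flatSharp hε, SemiRiem.sum_mul_flatSharp]
    ring
  have hN := hEinstein.isMetric
  -- The Einstein constant is `Sc/4` with `Sc = -48ab`.
  have hRic (q : N) : SemiRiem.ricci gN q = (-12 * a * b) • gN q := by
    rw [hEinstein.ricci_eq, hSc, finrank_euclideanSpace_fin]
    congr 1
    push_cast
    ring
  have hg1 : g = SemiRiem.conformalWarpedProduct ε gN (fun x ↦ a + b * SemiRiem.normSq ε x)
      (fun _ ↦ 1) := by
    rw [hg, SemiRiem.conformalWarpedProduct_one]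
  have hgs : (fun p ↦ (s p.1 ^ 2)⁻¹ • g p) =
      SemiRiem.conformalWarpedProduct ε gN (fun x ↦ a + b * SemiRiem.normSq ε x) s := by
    rw [hg]
    rfl
  have hmetric := SemiRiem.isMetricOn_conformalWarpedProduct hε hN hf'.contDiff
    (contDiff_const (c := (1 : ℝ)))
  simp only [ne_eq, one_ne_zero, not_false_eq_true, and_true] at hmetric
  refine ⟨hg1 ▸ hmetric, ⟨?_, fun p hp ↦ ?_⟩, ?_, fun p hfp hsp ↦ ?_⟩
  · exact (hs'.contDiff.contMDiff.comp contMDiff_fst).contMDiffOn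
  · have h := SemiRiem.hessian_add_smul_schouten_conformalWarpedProduct_one hε hN (hRic p.2) hf' hs'
      hp (by rw [hFF]; ring) (by rw [hSF, hsx]; linear_combination -2 * haB)
    rw [hg1, h]
    refine SemiRiem.traceFreePart_smul_self
      (E := EuclideanSpace ℝ (Fin m) × EuclideanSpace ℝ (Fin 4))
      (SemiRiem.isInvertible_of_nondegenerate (hmetric.nondegenerate p hp)) ?_ _
    rw [Module.finrank_prod, finrank_euclideanSpace_fin, finrank_euclideanSpace_fin]
    positivity
  · rw [hgs]
    exact SemiRiem.isMetricOn_conformalWarpedProduct hε hN hf'.contDiff hs'.contDiff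
  · rw [hgs, SemiRiem.scalarCurvature_conformalWarpedProduct hε hN (hRic p.2) hf' hs' hfp hsp,
      SemiRiem.flatForm_symm ε ((2 * b) • p.1) ((2 * B) • p.1 + _), hFF, hSF, hSS, hsx, hn]
    change a + b * SemiRiem.normSq ε p.1 ≠ 0 at hfp
    push_cast
    generalize SemiRiem.normSq ε p.1 = r at hfp ⊢
    generalize ∑ i, c i * p.1 i = t
    -- Here `y` is the value of `f`; eliminating `a` makes the denominator a single variable.
    obtain ⟨y, rfl⟩ : ∃ y, a = y - b * r := ⟨a + b * r, by ring⟩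
    simp only [sub_add_cancel] at hfp ⊢
    field_simp
    -- Without `aB = -bA`, `η(S,F)` differs from `2B f + 2b σ` by `-2(aB + bA)`. It is multiplied by
    -- `8(m+3) σ / f` in the scalar curvature, which gives the coefficient after clearing `f²`.
    linear_combination (-16 * (A + B * r + t) * (m + 3) * y) * haB
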